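/- Let $n,s\ge 0$ be integers, $T>0$, $K_0\subset\mathbb R^n$ compact, $\alpha\in\mathbb Z_{\ge0}^n$ a multi-index and $0<\eta\le\infty$. Let $\varrho_\eta\in C^\infty(\mathbb R^n)$ be real-valued and nonnegative with $\varrho_\eta(y)=1$ for $|y|\le\eta$ and $\varrho_\eta(y)=0$ for $|y|\ge2\eta$ if $\eta<\infty$, and $\varrho_\eta\equiv1$ if $\eta=\infty$. Let $x$ be $\mathbb R^n$-valued and let $\Phi,g$ be complex-valued functions such that - (P1) $x(t,z)\in C^\infty([0,T]\times\mathbb R^n)$; - (P2) $\Phi(t,y,z)\in C^\infty([0,T]\times\mathbb R^n\times\mathbb R^n)$; - (P3) $\nabla_y\Phi(t,0,z)$ is real for all $t\in[0,T]$, $z\in K_0$, and there is a constant $c>0$ such that $|\nabla_y\Phi(t,0,z)-\nabla_y\Phi(t,0,z')|+|x(t,z)-x(t,z')|\ge c|z-z'|$ for all $t\in[0,T]$ and $z,z'\in K_0$; - (P4) there is a constant $w>0$ such that $\operatorname{Im}\Phi(t,y,z)\ge w|y|^2$ for all $t\in[0,T]$, $z\in K_0$ and $|y|\le2\eta$ (all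 $y\in\mathbb R^n$ if $\eta=\infty$); - (P5) $g(t,y,z)\in C^\infty([0,T]\times\mathbb R^n\times K_0)$ does not depend on $\varepsilon$, and for every multi-index $\beta$ there is a constant $C_\beta$ such that $\sup_{y\in\mathbb R^n}|\partial_y^\beta g(t,y,z)|\le C_\beta$ for all $t\in[0,T]$, $z\in K_0$. If $\eta=\infty$, assume in addition that $\Phi(t,y,z)$ is a polynomial in $y$ whose coefficients are $C^\infty$ functions of $(t,z)\in[0,T]\times\mathbb R^n$. For $\varepsilon\in(0,1]$ put $$\mathcal I^\alpha_{\Phi,x,g}(t,y)=\varepsilon^{-\frac{n+|\alpha|}{2}}\int_{K_0}g(t,y,z)\,(y-x(t,z))^\alpha e^{i\Phi(t,y-x(t,z),z)/\varepsilon}\varrho_\eta(y-x(t,z))\,dz,$$ $$\|f\|_{H^s(\mathbb R^n)}=\sum_{|\beta|\le s}\|\partial^\beta f\|_{L^2(\mathbb R^n)},\qquad \|f\|_{H^s_\varepsilon(\mathbb R^n)}=\sum_{|\beta|\le s}\varepsilon^{|\beta|-s}\|\partial^\beta f\|_{L^2(\mathbb R^n)}.$$ Then $\mathcal I^\alpha_{\Phi,x,g}(t,\cdot)$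 is a $C^\infty$ function on $\mathbb R^n$ for every $t\in[0,T]$ and $\varepsilon\in(0,1]$, and there is a constant $C$, independent of $\varepsilon$, such that for all $\varepsilon\in(0,1]$ $$\sup_{t\in[0,T]}\|\mathcal I^\alpha_{\Phi,x,g}(t,\cdot)\|_{H^s(\mathbb R^n)}\le\sup_{t\in[0,T]}\|\mathcal I^\alpha_{\Phi,x,g}(t,\cdot)\|_{H^s_\varepsilon(\mathbb R^n)}\le C\varepsilon^{-s}.$$ -/

import Mathlib

open MeasureTheory Set
open scoped ENNReal ContDiff

noncomputable section

namespace GaussianBeam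

/-- `ℝⁿ` with its Euclidean norm and Lebesgue measure. -/
abbrev E (n : ℕ) : Type := EuclideanSpace ℝ (Fin n)

/-- Multi-indices of length `n`. -/
abbrev MultiIndex (n : ℕ) : Type := Fin n → ℕ

/-- The order `|α| = α₁ + ⋯ + αₙ`. -/
def order {n : ℕ} (α : MultiIndex n) : ℕ := ∑ i, α i

/-- The finite set of multi-indices with `|α| ≤ s`. -/
def multiIndicesLE (n s : ℕ) : Finset (MultiIndex n) :=
  (Fintype.piFinset fun _ : Fin n => Finset.range (s + 1)).filter fun α => order α ≤ s

/-- The filter above removes nothing but the multi-indices of order `> s`. -/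
theorem mem_multiIndicesLE {n s : ℕ} (α : MultiIndex n) :
    α ∈ multiIndicesLE n s ↔ order α ≤ s := by
  simp only [multiIndicesLE, Finset.mem_filter, Fintype.mem_piFinset, Finset.mem_range,
    and_iff_right_iff_imp]
  intro h i
  exact Nat.lt_succ_of_le (le_trans (Finset.single_le_sum (fun j _ => Nat.zero_le (α j))
    (Finset.mem_univ i)) h)

/-- The monomial `y^α`. -/
def monomial {n : ℕ} (α : MultiIndex n) (y : E n) : ℝ := ∏ i, y i ^ α i

/-- The partial derivative `∂f/∂yᵢ`. -/
def pderiv {n : ℕ} (i : Fin n) (f : E n → ℂ) : E n → ℂ :=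
  fun y => fderiv ℝ f y (EuclideanSpace.single i 1)

/-- The partial derivative `∂^β f = ∂₁^{β₁} ⋯ ∂ₙ^{βₙ} f` (used for smooth `f` only). -/
def partialD {n : ℕ} (β : MultiIndex n) (f : E n → ℂ) : E n → ℂ :=
  (List.finRange n).foldr (fun i h => (pderiv i)^[β i] h) f

/-- The norm `‖f‖_{H^s} = ∑_{|β| ≤ s} ‖∂^β f‖_{L²}` of a smooth function, with value `∞` if `f` is
not in `H^s`. -/
def sobolevNorm {n : ℕ} (s : ℕ) (f : E n → ℂ) : ℝ≥0∞ :=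
  ∑ β ∈ multiIndicesLE n s, eLpNorm (partialD β f) 2 volume

/-- The scaled norm `‖f‖_{H^s_ε} = ∑_{|β| ≤ s} ε^{|β| - s} ‖∂^β f‖_{L²}` of a smooth function. -/
def scaledSobolevNorm {n : ℕ} (ε : ℝ) (s : ℕ) (f : E n → ℂ) : ℝ≥0∞ :=
  ∑ β ∈ multiIndicesLE n s,
    ENNReal.ofReal (ε ^ ((order β : ℝ) - (s : ℝ))) * eLpNorm (partialD β f) 2 volume

/-- `ρ` is a cutoff function of radius `η ∈ (0, ∞]`: smooth, nonnegative, equal to `1` for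
`|z| ≤ η` and to `0` for `|z| ≥ 2η`. For `η = ∞` this says that `ρ = 1` everywhere. -/
structure IsCutoff {n : ℕ} (η : ℝ≥0∞) (ρ : E n → ℝ) : Prop where
  smooth : ContDiff ℝ ∞ ρ
  nonneg : ∀ z, 0 ≤ ρ z
  eq_one : ∀ z, ‖z‖ₑ ≤ η → ρ z = 1
  eq_zero : ∀ z, 2 * η ≤ ‖z‖ₑ → ρ z = 0

/-- The gradient `∇_y Φ(t, y, z) ∈ ℂⁿ`. -/
def gradY {n : ℕ} (Φ : ℝ → E n → E n → ℂ) (t : ℝ) (y z : E n) : EuclideanSpace ℂ (Fin n) :=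
  WithLp.toLp 2 fun i => pderiv i (fun y' => Φ t y' z) y

/-- (P1) `x ∈ C^∞([0,T] × ℝⁿ)`. -/
def P1 {n : ℕ} (T : ℝ) (x : ℝ → E n → E n) : Prop :=
  ContDiffOn ℝ ∞ (fun p : ℝ × E n => x p.1 p.2) (Icc 0 T ×ˢ univ)

/-- (P2) `Φ ∈ C^∞([0,T] × ℝⁿ × ℝⁿ)`. -/
def P2 {n : ℕ} (T : ℝ) (Φ : ℝ → E n → E n → ℂ) : Prop :=
  ContDiffOn ℝ ∞ (fun p : ℝ × E n × E n => Φ p.1 p.2.1 p.2.2) (Icc 0 T ×ˢ univ ×ˢ univ)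

/-- (P3) `∇_y Φ(t,0,z)` is real and
`|∇_y Φ(t,0,z) - ∇_y Φ(t,0,z')| + |x(t,z) - x(t,z')| ≥ C |z - z'|` on `[0,T] × K₀ × K₀`, for some
constant `C > 0`. -/
def P3 {n : ℕ} (T : ℝ) (K₀ : Set (E n)) (Φ : ℝ → E n → E n → ℂ) (x : ℝ → E n → E n) : Prop :=
  (∀ t ∈ Icc 0 T, ∀ z ∈ K₀, ∀ i, (gradY Φ t 0 z i).im = 0) ∧
  ∃ C : ℝ, 0 < C ∧ ∀ t ∈ Icc 0 T, ∀ z ∈ K₀, ∀ z' ∈ K₀,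
    C * ‖z - z'‖ ≤ ‖gradY Φ t 0 z - gradY Φ t 0 z'‖ + ‖x t z - x t z'‖

/-- (P4) `Im Φ(t,y,z) ≥ w |y|²` for `t ∈ [0,T]`, `z ∈ K₀`, `|y| ≤ 2η` (all `y` if `η = ∞`), for
some constant `w > 0`. -/
def P4 {n : ℕ} (T : ℝ) (K₀ : Set (E n)) (η : ℝ≥0∞) (Φ : ℝ → E n → E n → ℂ) : Prop :=
  ∃ w : ℝ, 0 < w ∧ ∀ t ∈ Icc 0 T, ∀ z ∈ K₀, ∀ y : E n, ‖y‖ₑ ≤ 2 * η →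
    w * ‖y‖ ^ 2 ≤ (Φ t y z).im

/-- (P5) `g ∈ C^∞([0,T] × ℝⁿ × K₀)` and every `∂_y^β g` is bounded on `[0,T] × ℝⁿ × K₀`. -/
def P5 {n : ℕ} (T : ℝ) (K₀ : Set (E n)) (g : ℝ → E n → E n → ℂ) : Prop :=
  ContDiffOn ℝ ∞ (fun p : ℝ × E n × E n => g p.1 p.2.1 p.2.2) (Icc 0 T ×ˢ univ ×ˢ K₀) ∧
  ∀ β : MultiIndex n, ∃ C : ℝ, ∀ t ∈ Icc 0 T, ∀ z ∈ K₀, ∀ y : E n,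
    ‖partialD β (fun y' => g t y' z) y‖ ≤ C

/-- `Φ(t,y,z)` is a polynomial in `y` with coefficients in `C^∞([0,T] × ℝⁿ)`, as Gaussian beam
phases are. -/
def IsPolynomialPhase {n : ℕ} (T : ℝ) (Φ : ℝ → E n → E n → ℂ) : Prop :=
  ∃ (d : ℕ) (c : MultiIndex n → ℝ → E n → ℂ),
    (∀ β, ContDiffOn ℝ ∞ (fun p : ℝ × E n => c β p.1 p.2) (Icc 0 T ×ˢ univ)) ∧
    ∀ t ∈ Icc 0 T, ∀ y z : E n,
      Φ t y z = ∑ β ∈ multiIndicesLE n d, c β t z * (monomial β y : ℂ)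

/-- The oscillatory integral
`ε^{-(n+|α|)/2} ∫_{K₀} g(t,y,z) (y-x(t,z))^α e^{iΦ(t,y-x(t,z),z)/ε} ρ(y-x(t,z)) dz`. -/
def oscIntegral {n : ℕ} (K₀ : Set (E n)) (ρ : E n → ℝ) (α : MultiIndex n)
    (Φ : ℝ → E n → E n → ℂ) (x : ℝ → E n → E n) (g : ℝ → E n → E n → ℂ)
    (ε t : ℝ) (y : E n) : ℂ :=
  ((ε ^ (-(((n : ℝ) + (order α : ℝ)) / 2)) : ℝ) : ℂ) *
    ∫ z in K₀, g t y z * (monomial α (y - x t z) : ℂ) *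
      Complex.exp (Complex.I * Φ t (y - x t z) z / (ε : ℂ)) * (ρ (y - x t z) : ℂ)

end GaussianBeam

end

/-! Put `r = √ε`. Near its centre the integrand is a wave packet: once the linear part `p·(y - x)`
of the phase is split off, with `p = ∇_yΦ(t,0,z)` real by (P3), the rest is a profile in the
variable `v = (y - x)/r`. The factor `(y - x)^α = r^|α| v^α` uses up `ε^{-|α|/2}`, leaving the
prefactor `r⁻ⁿ`. By (P4) the profile and its derivatives are bounded by a polynomial times
`e^{-w|v|²}`, uniformly in `ε`, `t`, `z` (`gaussGrowth_profile`). Differentiating in `y` again gives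
a packet with the same centre and momentum, at the price of `r⁻² = ε⁻¹` (`exists_partialD_packet`).

A bound on each packet separately would give only `r^{n/2}` for the `L²` norm of the superposition;
the needed `rⁿ` comes from almost orthogonality. The squared norm is the integral over `K₀ × K₀` of
the correlations of two packets. Such a correlation is `rⁿ` times a Fourier integral of two profiles
shifted by `δ = (x' - x)/r`, at frequency `q = (p - p')/r`. Gaussian decay handles `δ`, integration
by parts handles `q`, and together they give `(1 + |δ| + |q|)^{-(n+1)}`
(`exists_profile_correlation_bound`). By (P3), `|δ| + |q| ≥ c|z - z'|/r`, so integrating over `z'`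
yields another `rⁿ` (`integral_decay_kernel_le`). The squared norm is thus `O(r^{2n})`, which
cancels the prefactor, and `∂^β` costs `ε^{-|β|}` (`exists_bound_partialD_oscIntegral`). With the
weight `ε^{|β|-s}` every term of the scaled norm is `O(ε^{-s})`; the weights are at least `1`, which
gives the comparison of the two norms. -/

noncomputable section

namespace GaussianBeam

section


/-! ### Smooth families over a parameter set and differentiation under the integral -/

section Slices

variable {X V F : Type} [NormedAddCommGroup X] [NormedSpace ℝ X] [NormedAddCommGroup V]
  [NormedSpace ℝ V] [NormedAddCommGroup F] [NormedSpace ℝ F] {A : Set X}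

/-- `G(a, v)` is jointly smooth on `A × V`, where `A` may be an arbitrary set of parameters. -/
def SmoothSlices (A : Set X) (G : X → V → F) : Prop :=
  ContDiffOn ℝ ∞ (fun q : X × V => G q.1 q.2) (A ×ˢ univ)

theorem SmoothSlices.contDiff {G : X → V → F} (h : SmoothSlices A G) {a : X} (ha : a ∈ A) :
    ContDiff ℝ ∞ (G a) := by
  rw [← contDiffOn_univ]
  exact h.comp (f := fun v => (a, v)) (contDiff_const.prodMk contDiff_id).contDiffOn
    fun v _ => ⟨ha, mem_univ _⟩

/-- The set `A` may be irregular, so derivatives in the parameter are not determined. Any local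
derivative within `A × V`, restricted to the fibre `{a} × V`, is nevertheless the true derivative in
`v`, and it inherits joint smoothness. -/
theorem SmoothSlices.fderiv {G : X → V → F} (h : SmoothSlices A G) :
    SmoothSlices A fun a v => fderiv ℝ (G a) v := by
  refine contDiffOn_infty.2 fun m q hq => ?_
  have h1 : ContDiffWithinAt ℝ ((m : ℕ∞ω) + 1) (fun q : X × V => G q.1 q.2) (A ×ˢ univ) q :=
    (h q hq).of_le (by exact_mod_cast le_top)
  obtain ⟨u, hu, hus, -, f', hf', hc⟩ :=
    (contDiffWithinAt_succ_iff_hasFDerivWithinAt' (by simp)).1 h1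
  rw [insert_eq_of_mem hq] at hu hus
  have hc' : ContDiffWithinAt ℝ m
      (fun q => (f' q).comp (ContinuousLinearMap.inr ℝ X V)) (A ×ˢ univ) q :=
    hc.clm_comp contDiffWithinAt_const
  have key : ∀ q ∈ u, _root_.fderiv ℝ (G q.1) q.2
      = (f' q).comp (ContinuousLinearMap.inr ℝ X V) := by
    intro q hqu
    have h2 : HasFDerivWithinAt (fun v : V => (q.1, v)) (ContinuousLinearMap.inr ℝ X V) univ q.2 :=
      (hasFDerivAt_prodMk_right q.1 q.2).hasFDerivWithinAt
    have h3 := (hf' q hqu).comp (t := A ×ˢ univ) (f := fun v : V => (q.1, v)) q.2 h2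
      (fun v _ => ⟨(hus hqu).1, mem_univ _⟩)
    rw [hasFDerivWithinAt_univ] at h3
    exact h3.fderiv
  exact hc'.congr_of_eventuallyEq (Filter.mem_of_superset hu key)
    (key q (mem_of_mem_nhdsWithin hq hu))

theorem SmoothSlices.clm_apply_const {G : X → V → V →L[ℝ] F} (h : SmoothSlices A G) (e : V) :
    SmoothSlices A fun a v => G a v e :=
  ContDiffOn.clm_apply h contDiffOn_const

/-- The codomain is quantified inside because the induction passes from `G` to its derivative, which
takes values in `V →L[ℝ] F`. -/
theorem SmoothSlices.continuousOn_norm_iteratedFDeriv (k : ℕ) : ∀ {F : Type}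
    [NormedAddCommGroup F] [NormedSpace ℝ F] {G : X → V → F}, SmoothSlices A G →
    ContinuousOn (fun q : X × V => ‖iteratedFDeriv ℝ k (G q.1) q.2‖) (A ×ˢ univ) := by
  induction k with
  | zero =>
    intro F _ _ G h
    simpa only [norm_iteratedFDeriv_zero] using h.continuousOn.norm
  | succ k ih =>
    intro F _ _ G h
    simpa only [norm_iteratedFDeriv_fderiv] using ih h.fderiv

theorem SmoothSlices.exists_bound_iteratedFDeriv {G : X → V → F} (h : SmoothSlices A G)
    (hA : IsCompact A) {B : Set V} (hB : IsCompact B) (k : ℕ) :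
    ∃ C : ℝ, ∀ a ∈ A, ∀ v ∈ B, ‖iteratedFDeriv ℝ k (G a) v‖ ≤ C := by
  obtain ⟨C, hC⟩ := (hA.prod hB).exists_bound_of_continuousOn
    ((h.continuousOn_norm_iteratedFDeriv k).mono (prod_mono_right (subset_univ _)))
  exact ⟨C, fun a ha v hv => by simpa using hC (a, v) ⟨ha, hv⟩⟩

theorem SmoothSlices.continuousOn_left {G : X → V → F} (h : SmoothSlices A G) (v : V) :
    ContinuousOn (fun a => G a v) A :=
  h.continuousOn.comp (f := fun a => (a, v)) (by fun_prop) fun _ ha => ⟨ha, mem_univ _⟩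

section Integral

variable [MeasurableSpace X] [BorelSpace X] {μ : Measure X} [IsFiniteMeasureOnCompacts μ]

theorem SmoothSlices.integrableOn {G : X → V → F} (h : SmoothSlices A G) (hA : IsCompact A)
    (v : V) : IntegrableOn (fun a => G a v) A μ :=
  (h.continuousOn_left v).integrableOn_compact hA

variable [ProperSpace V]

theorem SmoothSlices.hasFDerivAt_integral {G : X → V → F}
    (h : SmoothSlices A G) (hA : IsCompact A) (v : V) :
    HasFDerivAt (fun v => ∫ a in A, G a v ∂μ) (∫ a in A, _root_.fderiv ℝ (G a) v ∂μ) v := by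
  obtain ⟨C, hC⟩ := (hA.prod (isCompact_closedBall v 1)).exists_bound_of_continuousOn
    (h.fderiv.continuousOn.mono (prod_mono_right (subset_univ _)))
  have hAm := hA.measurableSet
  refine hasFDerivAt_integral_of_dominated_of_fderiv_le (s := Metric.closedBall v 1)
    (F := fun v a => G a v) (F' := fun v a => _root_.fderiv ℝ (G a) v)
    (bound := fun _ => C) (Metric.closedBall_mem_nhds v one_pos)
    (Filter.Eventually.of_forall fun v => (h.integrableOn hA v).aestronglyMeasurable)
    (h.integrableOn hA v) (h.fderiv.integrableOn hA v).aestronglyMeasurable ?_ ?_ ?_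
  · exact (ae_restrict_iff' hAm).2 (Filter.Eventually.of_forall fun a ha v hv => hC (a, v) ⟨ha, hv⟩)
  · exact integrableOn_const hA.measure_ne_top
  · exact (ae_restrict_iff' hAm).2 (Filter.Eventually.of_forall fun a ha v _ =>
      ((h.contDiff ha).differentiable (by simp) v).hasFDerivAt)

theorem SmoothSlices.contDiff_integral_nat (hA : IsCompact A) (m : ℕ) : ∀ {F : Type}
    [NormedAddCommGroup F] [NormedSpace ℝ F] {G : X → V → F}, SmoothSlices A G →
    ContDiff ℝ m fun v => ∫ a in A, G a v ∂μ := by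
  induction m with
  | zero =>
    intro F _ _ G h
    exact contDiff_zero.2 (continuous_iff_continuousAt.2 fun v =>
      (h.hasFDerivAt_integral hA v).continuousAt)
  | succ m ih =>
    intro F _ _ G h
    exact contDiff_succ_iff_hasFDerivAt.2 ⟨_, ih h.fderiv, h.hasFDerivAt_integral hA⟩

theorem SmoothSlices.contDiff_integral {G : X → V → F} (h : SmoothSlices A G)
    (hA : IsCompact A) : ContDiff ℝ ∞ fun v => ∫ a in A, G a v ∂μ :=
  contDiff_infty.2 fun m => SmoothSlices.contDiff_integral_nat hA m h

end Integral

end Slices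

/-! ### Iterated partial derivatives -/

section PartialDerivatives

variable {n : ℕ} {X : Type} [NormedAddCommGroup X] [NormedSpace ℝ X] {A : Set X}

/-- Induction principle for iterated partial derivatives of a family of functions, for a property
that keeps count of the number of derivatives taken. -/
theorem partialD_induction {ι : Type} {P : ℕ → (ι → E n → ℂ) → Prop}
    (step : ∀ i m f, P m f → P (m + 1) fun a => pderiv i (f a)) {f : ι → E n → ℂ} (h : P 0 f)
    (β : MultiIndex n) : P (order β) fun a => partialD β (f a) := by
  have it : ∀ (i : Fin n) (k m : ℕ) (f : ι → E n → ℂ), P m f →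
      P (m + k) fun a => (pderiv i)^[k] (f a) := by
    intro i k
    induction k with
    | zero => intro m f hf; exact hf
    | succ k ih =>
      intro m f hf
      simp only [Function.iterate_succ_apply']
      exact step i _ _ (ih m f hf)
  have hl : ∀ l : List (Fin n), P ((l.map β).sum)
      fun a => l.foldr (fun i h => (pderiv i)^[β i] h) (f a) := by
    intro l
    induction l with
    | nil => exact h
    | cons i l ih =>
      simp only [List.map_cons, List.sum_cons, List.foldr_cons]
      rw [add_comm]
      exact it i _ _ _ ih
  have := hl (List.finRange n)
  rwa [← List.ofFn_eq_map, List.sum_ofFn] at this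

theorem SmoothSlices.pderiv {G : X → E n → ℂ} (h : SmoothSlices A G) (i : Fin n) :
    SmoothSlices A fun a => pderiv i (G a) :=
  h.fderiv.clm_apply_const _

theorem SmoothSlices.partialD {G : X → E n → ℂ} (h : SmoothSlices A G) (β : MultiIndex n) :
    SmoothSlices A fun a => partialD β (G a) :=
  partialD_induction (P := fun _ G => SmoothSlices A G) (fun i _ _ h => h.pderiv i) h β

theorem SmoothSlices.partialD_integral [MeasurableSpace X] [BorelSpace X]
    {μ : Measure X} [IsFiniteMeasureOnCompacts μ]
    {G : X → E n → ℂ} (h : SmoothSlices A G) (hA : IsCompact A) (β : MultiIndex n) :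
    GaussianBeam.partialD β (fun y => ∫ a in A, G a y ∂μ)
      = fun y => ∫ a in A, GaussianBeam.partialD β (G a) y ∂μ := by
  -- The integral joins the family as the extra member `none`, so one induction follows the
  -- integrand and the integral together.
  let f : Option X → E n → ℂ := fun o => o.elim (fun y => ∫ a in A, G a y ∂μ) G
  refine (partialD_induction (f := f) (P := fun _ f => SmoothSlices A (fun a => f (some a)) ∧
    f none = fun y => ∫ a in A, f (some a) y ∂μ) ?_ ⟨h, rfl⟩ β).2
  rintro i - f ⟨hf, hn⟩
  refine ⟨hf.pderiv i, funext fun y => ?_⟩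
  simp only [hn, GaussianBeam.pderiv]
  rw [(hf.hasFDerivAt_integral hA y).fderiv,
    ContinuousLinearMap.integral_apply (hf.fderiv.integrableOn hA y)]

theorem contDiff_pderiv {f : E n → ℂ} (h : ContDiff ℝ ∞ f) (i : Fin n) :
    ContDiff ℝ ∞ (pderiv i f) :=
  (h.fderiv_right (m := ∞) (by simp)).clm_apply contDiff_const

theorem pderiv_comm {f : E n → ℂ} (h : ContDiff ℝ ∞ f) (i j : Fin n) :
    pderiv i (pderiv j f) = pderiv j (pderiv i f) := by
  have hd : Differentiable ℝ (fderiv ℝ f) :=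
    (h.fderiv_right (m := ∞) (by simp)).differentiable (by simp)
  have key : ∀ (i j : Fin n) y, pderiv i (pderiv j f) y
      = fderiv ℝ (fderiv ℝ f) y (EuclideanSpace.single i 1) (EuclideanSpace.single j 1) := by
    intro i j y
    have := ((hd y).hasFDerivAt.clm_apply
      (hasFDerivAt_const (EuclideanSpace.single j (1 : ℝ)) y)).fderiv
    change fderiv ℝ (fun y => fderiv ℝ f y (EuclideanSpace.single j 1)) y _ = _
    rw [this]
    simp
  funext y
  rw [key, key]
  exact (h.contDiffAt.isSymmSndFDerivAt (by simpa using ENat.LEInfty.out)) _ _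

theorem iterate_pderiv_comm {f : E n → ℂ} (h : ContDiff ℝ ∞ f) (i j : Fin n) (k : ℕ) :
    ContDiff ℝ ∞ ((pderiv i)^[k] f) ∧
      (pderiv i)^[k] (pderiv j f) = pderiv j ((pderiv i)^[k] f) := by
  induction k with
  | zero => exact ⟨h, rfl⟩
  | succ k ih =>
    simp only [Function.iterate_succ_apply']
    exact ⟨contDiff_pderiv ih.1 i, by rw [ih.2, pderiv_comm ih.1]⟩

theorem foldr_pderiv_comm {f : E n → ℂ} (h : ContDiff ℝ ∞ f) (β : MultiIndex n) (j : Fin n)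
    (l : List (Fin n)) :
    ContDiff ℝ ∞ (l.foldr (fun i h => (pderiv i)^[β i] h) f) ∧
    l.foldr (fun i h => (pderiv i)^[β i] h) (pderiv j f)
      = pderiv j (l.foldr (fun i h => (pderiv i)^[β i] h) f) := by
  induction l with
  | nil => exact ⟨h, rfl⟩
  | cons i l ih =>
    simp only [List.foldr_cons]
    exact ⟨(iterate_pderiv_comm ih.1 i j _).1, by
      rw [ih.2, (iterate_pderiv_comm ih.1 i j _).2]⟩

/-- Partial derivatives of a smooth function commute, so the extra one moves outwards through the
list until it meets the block of its own index, which occurs exactly once. -/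
theorem partialD_pderiv {f : E n → ℂ} (h : ContDiff ℝ ∞ f) (β : MultiIndex n) (j : Fin n) :
    partialD β (pderiv j f) = partialD (β + Pi.single j 1) f := by
  have hne : ∀ l : List (Fin n), j ∉ l →
      l.foldr (fun i h => (pderiv i)^[(β + Pi.single j 1 : MultiIndex n) i] h) f
        = l.foldr (fun i h => (pderiv i)^[β i] h) f := by
    intro l hl
    induction l with
    | nil => rfl
    | cons i l ih =>
      rw [List.mem_cons, not_or] at hl
      simp only [List.foldr_cons, ih hl.2]
      simp [Pi.single_eq_of_ne (Ne.symm hl.1)]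
  have hl : ∀ l : List (Fin n), l.Nodup → j ∈ l →
      l.foldr (fun i h => (pderiv i)^[β i] h) (pderiv j f)
        = l.foldr (fun i h => (pderiv i)^[(β + Pi.single j 1 : MultiIndex n) i] h) f := by
    intro l hnd hj
    induction l with
    | nil => simp at hj
    | cons i l ih =>
      rw [List.nodup_cons] at hnd
      simp only [List.foldr_cons]
      by_cases hij : i = j
      · subst hij
        rw [hne l hnd.1, (foldr_pderiv_comm h β i l).2, ← Function.iterate_succ_apply]
        simp
      · rw [ih hnd.2 ((List.mem_cons.1 hj).resolve_left (Ne.symm hij))]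
        simp [Pi.single_eq_of_ne hij]
  exact hl _ (List.nodup_finRange n) (List.mem_finRange j)

theorem fderiv_eq_sum_pderiv (f : E n → ℂ) (y : E n) :
    fderiv ℝ f y = ∑ j, ContinuousLinearMap.smulRightL ℝ (E n) ℂ
      (EuclideanSpace.proj j : E n →L[ℝ] ℝ) (pderiv j f y) := by
  refine ContinuousLinearMap.coe_inj.1 ((EuclideanSpace.basisFun (Fin n) ℝ).toBasis.ext fun i => ?_)
  simp [pderiv, apply_ite (Complex.ofReal)]

/-- Bounds on all partial derivatives of a family give bounds on its iterated derivatives. -/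
theorem exists_bound_iteratedFDeriv_of_partialD {ι : Type} (k : ℕ) : ∀ {f : ι → E n → ℂ},
    (∀ a, ContDiff ℝ ∞ (f a)) → (∀ β, ∃ C : ℝ, ∀ a y, ‖partialD β (f a) y‖ ≤ C) →
    ∃ C : ℝ, ∀ a y, ‖iteratedFDeriv ℝ k (f a) y‖ ≤ C := by
  induction k with
  | zero =>
    intro f _ hb
    obtain ⟨C, hC⟩ := hb 0
    refine ⟨C, fun a y => ?_⟩
    have h0 : partialD 0 (f a) = f a := by
      have : ∀ l : List (Fin n), l.foldr (fun i h => (pderiv i)^[(0 : MultiIndex n) i] h) (f a)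
          = f a := by
        intro l
        induction l with
        | nil => rfl
        | cons i l ih => simp
      exact this _
    rw [norm_iteratedFDeriv_zero, ← h0]
    exact hC a y
  | succ k ih =>
    intro f hf hb
    have hj : ∀ j : Fin n, ∃ C : ℝ, ∀ a y, ‖iteratedFDeriv ℝ k (pderiv j (f a)) y‖ ≤ C := by
      intro j
      refine ih (f := fun a => pderiv j (f a)) (fun a => contDiff_pderiv (hf a) j) fun β => ?_
      obtain ⟨C, hC⟩ := hb (β + Pi.single j 1)
      exact ⟨C, fun a y => by rw [partialD_pderiv (hf a)]; exact hC a y⟩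
    choose C hC using hj
    let L : Fin n → ℂ →L[ℝ] E n →L[ℝ] ℂ := fun j =>
      ContinuousLinearMap.smulRightL ℝ (E n) ℂ (EuclideanSpace.proj j : E n →L[ℝ] ℝ)
    refine ⟨∑ j, ‖L j‖ * C j, fun a y => ?_⟩
    rw [← norm_iteratedFDeriv_fderiv]
    have hs : ∀ j, ContDiff ℝ ∞ (L j ∘ pderiv j (f a)) := fun j =>
      (L j).contDiff.comp (contDiff_pderiv (hf a) j)
    -- The derivative is a sum of fixed linear maps applied to the partial derivatives, so order `k
    -- + 1` of `f` reduces to order `k` of each `∂ⱼf`.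
    have he : fderiv ℝ (f a) = fun y => ∑ j, (L j ∘ pderiv j (f a)) y :=
      funext fun y => fderiv_eq_sum_pderiv _ y
    rw [he, iteratedFDeriv_fun_sum_apply fun j _ => ((hs j).of_le (by exact_mod_cast le_top)).contDiffAt]
    refine (norm_sum_le _ _).trans (Finset.sum_le_sum fun j _ => ?_)
    refine ((L j).norm_iteratedFDeriv_comp_left (N := ∞) (contDiff_pderiv (hf a) j).contDiffAt
      (by exact_mod_cast le_top)).trans ?_
    gcongr
    exact hC j a y

end PartialDerivatives

end

/-! ### Calculus of functions with Gaussian bounds -/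

section


variable {n : ℕ} {ι : Type}

/-- The derivatives of the functions `f i` are bounded on `S i` by a polynomial times the Gaussian
`e^{-κ|v|²}`, uniformly in `i`. -/
structure GaussGrowth (κ : ℝ) (S : ι → Set (E n)) (f : ι → E n → ℂ) : Prop where
  smooth : ∀ i, ContDiff ℝ ∞ (f i)
  bound : ∀ k, ∃ (C : ℝ) (M : ℕ), ∀ i, ∀ v ∈ S i,
    ‖iteratedFDeriv ℝ k (f i) v‖ ≤ C * (1 + ‖v‖) ^ M * Real.exp (-κ * ‖v‖ ^ 2)

/-- Finitely many bounds of polynomial growth may be replaced by one. -/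
theorem exists_uniform_growth {κ : ℝ} {S : ι → Set (E n)} {N : ℕ → ι → E n → ℝ} {p : ℕ → Prop}
    (h : ∀ k, p k → ∃ (C : ℝ) (M : ℕ), ∀ i, ∀ v ∈ S i,
      N k i v ≤ C * (1 + ‖v‖) ^ M * Real.exp (-κ * ‖v‖ ^ 2)) (k : ℕ) :
    ∃ (C : ℝ) (M : ℕ), 0 ≤ C ∧ ∀ j ≤ k, p j → ∀ i, ∀ v ∈ S i,
      N j i v ≤ C * (1 + ‖v‖) ^ M * Real.exp (-κ * ‖v‖ ^ 2) := by
  induction k with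
  | zero =>
    by_cases h0 : p 0
    · obtain ⟨C, M, hC⟩ := h 0 h0
      refine ⟨|C|, M, abs_nonneg _, fun j hj _ i v hv => ?_⟩
      obtain rfl := Nat.le_zero.1 hj
      exact (hC i v hv).trans (by gcongr; exact le_abs_self C)
    · refine ⟨0, 0, le_rfl, fun j hj hp => ?_⟩
      obtain rfl := Nat.le_zero.1 hj
      exact absurd hp h0
  | succ k ih =>
    obtain ⟨C, M, hC0, hC⟩ := ih
    by_cases hk : p (k + 1)
    · obtain ⟨C', M', hC'⟩ := h (k + 1) hk
      refine ⟨max C |C'|, max M M', le_max_of_le_left hC0, fun j hj hp i v hv => ?_⟩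
      have h1 : 1 ≤ 1 + ‖v‖ := by linarith [norm_nonneg v]
      rcases Nat.le_succ_iff.1 hj with hj | rfl
      · refine (hC j hj hp i v hv).trans ?_
        gcongr
        · exact le_max_left _ _
        · exact le_max_left _ _
      · refine (hC' i v hv).trans ?_
        gcongr
        · exact (le_abs_self C').trans (le_max_right _ _)
        · exact le_max_right _ _
    · refine ⟨C, M, hC0, fun j hj hp i v hv => ?_⟩
      rcases Nat.le_succ_iff.1 hj with hj | rfl
      · exact hC j hj hp i v hv
      · exact absurd hp hk

theorem GaussGrowth.uniform {κ : ℝ} {S : ι → Set (E n)} {f : ι → E n → ℂ}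
    (h : GaussGrowth κ S f) (k : ℕ) : ∃ (C : ℝ) (M : ℕ), 0 ≤ C ∧ ∀ j ≤ k, ∀ i, ∀ v ∈ S i,
      ‖iteratedFDeriv ℝ j (f i) v‖ ≤ C * (1 + ‖v‖) ^ M * Real.exp (-κ * ‖v‖ ^ 2) := by
  obtain ⟨C, M, h0, hC⟩ := exists_uniform_growth (p := fun _ => True)
    (N := fun k i v => ‖iteratedFDeriv ℝ k (f i) v‖) (fun k _ => h.bound k) k
  exact ⟨C, M, h0, fun j hj => hC j hj trivial⟩

theorem GaussGrowth.mul {κ κ' : ℝ} {S : ι → Set (E n)} {f g : ι → E n → ℂ}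
    (hf : GaussGrowth κ S f) (hg : GaussGrowth κ' S g) :
    GaussGrowth (κ + κ') S fun i v => f i v * g i v := by
  refine ⟨fun i => (hf.smooth i).mul (hg.smooth i), fun k => ?_⟩
  obtain ⟨C, M, hC0, hC⟩ := hf.uniform k
  obtain ⟨C', M', hC0', hC'⟩ := hg.uniform k
  refine ⟨2 ^ k * (C * C'), M + M', fun i v hv => ?_⟩
  refine (norm_iteratedFDeriv_mul_le (N := ∞) (hf.smooth i) (hg.smooth i) v
    (by exact_mod_cast le_top)).trans ?_
  calc _ ≤ ∑ j ∈ Finset.range (k + 1), (k.choose j : ℝ) *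
        (C * (1 + ‖v‖) ^ M * Real.exp (-κ * ‖v‖ ^ 2)) *
        (C' * (1 + ‖v‖) ^ M' * Real.exp (-κ' * ‖v‖ ^ 2)) := by
        refine Finset.sum_le_sum fun j hj => ?_
        gcongr
        · exact hC j (by simpa [Nat.lt_succ_iff] using hj) i v hv
        · exact hC' (k - j) (Nat.sub_le _ _) i v hv
    _ = _ := by
        rw [← Finset.sum_mul, ← Finset.sum_mul, ← Nat.cast_sum, Nat.sum_range_choose,
          show -(κ + κ') * ‖v‖ ^ 2 = -κ * ‖v‖ ^ 2 + -κ' * ‖v‖ ^ 2 by ring, Real.exp_add]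
        push_cast
        ring

theorem GaussGrowth.add {κ : ℝ} {S : ι → Set (E n)} {f g : ι → E n → ℂ}
    (hf : GaussGrowth κ S f) (hg : GaussGrowth κ S g) :
    GaussGrowth κ S fun i v => f i v + g i v := by
  refine ⟨fun i => (hf.smooth i).add (hg.smooth i), fun k => ?_⟩
  obtain ⟨C, M, hC0, hC⟩ := hf.uniform k
  obtain ⟨C', M', hC0', hC'⟩ := hg.uniform k
  refine ⟨C + C', M + M', fun i v hv => ?_⟩
  have h1 : 1 ≤ 1 + ‖v‖ := by linarith [norm_nonneg v]
  have hk : (k : ℕ∞ω) ≤ (∞ : ℕ∞ω) := by exact_mod_cast le_top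
  rw [fun_iteratedFDeriv_add_apply (((hf.smooth i).of_le hk).contDiffAt)
    (((hg.smooth i).of_le hk).contDiffAt)]
  refine (norm_add_le _ _).trans ((add_le_add (hC k le_rfl i v hv) (hC' k le_rfl i v hv)).trans ?_)
  rw [add_mul, add_mul]
  gcongr <;> first | exact h1 | omega

theorem GaussGrowth.const {S : ι → Set (E n)} {c : ι → ℂ} {B : ℝ} (hc : ∀ i, ‖c i‖ ≤ B) :
    GaussGrowth 0 S fun i (_ : E n) => c i := by
  refine ⟨fun i => contDiff_const, fun k => ⟨B, 0, fun i v _ => ?_⟩⟩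
  rcases Nat.eq_zero_or_pos k with rfl | hk
  · simpa using hc i
  · rw [iteratedFDeriv_const_of_ne hk.ne']
    simpa using (norm_nonneg _).trans (hc i)

theorem GaussGrowth.pderiv {κ : ℝ} {S : ι → Set (E n)} {f : ι → E n → ℂ}
    (hf : GaussGrowth κ S f) (j : Fin n) : GaussGrowth κ S fun i => pderiv j (f i) := by
  refine ⟨fun i => contDiff_pderiv (hf.smooth i) j, fun k => ?_⟩
  obtain ⟨C, M, hC⟩ := hf.bound (k + 1)
  refine ⟨C, M, fun i v hv => le_trans ?_ (hC i v hv)⟩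
  refine (norm_iteratedFDeriv_clm_apply_const (N := ∞)
    ((hf.smooth i).fderiv_right (m := ∞) (by simp)).contDiffAt (by exact_mod_cast le_top)).trans ?_
  simp [norm_iteratedFDeriv_fderiv]

/-- Off the closed set `S i` the function vanishes on an open set, hence so do all its derivatives.
-/
theorem GaussGrowth.of_eq_zero {κ : ℝ} {S : ι → Set (E n)} {f : ι → E n → ℂ}
    (hf : GaussGrowth κ S f) (hS : ∀ i, IsClosed (S i)) (h0 : ∀ i, ∀ v ∉ S i, f i v = 0) :
    GaussGrowth κ (fun _ => univ) f := by
  refine ⟨hf.smooth, fun k => ?_⟩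
  obtain ⟨C, M, hC0, hC⟩ := hf.uniform k
  refine ⟨C, M, fun i v _ => ?_⟩
  by_cases hv : v ∈ S i
  · exact hC k le_rfl i v hv
  · have : f i =ᶠ[nhds v] fun _ => 0 :=
      Filter.mem_of_superset ((hS i).isOpen_compl.mem_nhds hv) (h0 i)
    rw [(this.iteratedFDeriv ℝ k).eq_of_nhds]
    rw [iteratedFDeriv_fun_zero, Pi.zero_apply, norm_zero]
    positivity

/-- The chain rule produces `r^k`, which is at most `1`: contraction does not enlarge derivatives.
-/
theorem GaussGrowth.comp_scale {S : ι → Set (E n)} {f : ι → E n → ℂ} {r : ι → ℝ} {x : ι → E n}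
    (hf : ∀ i, ContDiff ℝ ∞ (f i)) (hr : ∀ i, |r i| ≤ 1)
    (hb : ∀ k, ∃ (C : ℝ) (M : ℕ), ∀ i, ∀ v ∈ S i,
      ‖iteratedFDeriv ℝ k (f i) (x i + r i • v)‖ ≤ C * (1 + ‖v‖) ^ M) :
    GaussGrowth 0 S fun i v => f i (x i + r i • v) := by
  refine ⟨fun i => (hf i).comp (contDiff_const.add (contDiff_id.const_smul _)), fun k => ?_⟩
  obtain ⟨C, M, hC⟩ := hb k
  refine ⟨C, M, fun i v hv => ?_⟩
  have hk : (k : ℕ∞ω) ≤ (∞ : ℕ∞ω) := by exact_mod_cast le_top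
  have hs : ContDiff ℝ k fun v => f i (x i + v) :=
    ((hf i).comp (contDiff_const.add contDiff_id)).of_le hk
  have := congrFun (iteratedFDeriv_comp_const_smul (r i) hs) v
  rw [this, iteratedFDeriv_comp_add_left, norm_smul, norm_pow, Real.norm_eq_abs]
  have h1 : |r i| ^ k ≤ 1 := pow_le_one₀ (abs_nonneg _) (hr i)
  calc _ ≤ 1 * (C * (1 + ‖v‖) ^ M) := by gcongr; exact hC i v hv
    _ = _ := by simp

/-- The real derivative of `exp` is `exp` followed by the multiplication map, whose norm is at most
`1`. -/
theorem norm_iteratedFDeriv_cexp_le (k : ℕ) (z : ℂ) :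
    ‖iteratedFDeriv ℝ k Complex.exp z‖ ≤ ‖Complex.exp z‖ := by
  induction k with
  | zero => simp
  | succ k ih =>
    have he : fderiv ℝ Complex.exp = ContinuousLinearMap.mul ℝ ℂ ∘ Complex.exp := by
      funext z
      rw [((Complex.hasDerivAt_exp z).hasFDerivAt.restrictScalars ℝ).fderiv]
      ext
      simp [mul_comm]
    rw [← norm_iteratedFDeriv_fderiv, he]
    refine ((ContinuousLinearMap.mul ℝ ℂ).norm_iteratedFDeriv_comp_left (N := ∞)
      (Complex.contDiff_exp.contDiffAt) (by exact_mod_cast le_top)).trans ?_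
    refine (mul_le_mul (ContinuousLinearMap.opNorm_mul_le ℝ ℂ) ih (norm_nonneg _) zero_le_one).trans ?_
    simp

/-- Only derivatives of order at least one of the exponent need a bound; its value enters through
the real part alone. This matters because `Re Φ(t,0,z)/ε` is unbounded as `ε → 0`. -/
theorem GaussGrowth.cexp {κ : ℝ} {S : ι → Set (E n)} {f : ι → E n → ℂ}
    (hf : ∀ i, ContDiff ℝ ∞ (f i))
    (hb : ∀ k, 1 ≤ k → ∃ (C : ℝ) (M : ℕ), ∀ i, ∀ v ∈ S i,
      ‖iteratedFDeriv ℝ k (f i) v‖ ≤ C * (1 + ‖v‖) ^ M)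
    (he : ∀ i, ∀ v ∈ S i, (f i v).re ≤ -κ * ‖v‖ ^ 2) :
    GaussGrowth κ S fun i v => Complex.exp (f i v) := by
  refine ⟨fun i => Complex.contDiff_exp.comp (hf i), fun k => ?_⟩
  obtain ⟨C, M, hC0, hC⟩ := exists_uniform_growth (p := fun k => 1 ≤ k) (κ := 0) (S := S)
    (N := fun k i v => ‖iteratedFDeriv ℝ k (f i) v‖) (fun k hk => by simpa using hb k hk) k
  -- The composition estimate gives `k! · sup‖exp⁽ʲ⁾‖ · Dᵏ`, where `Dʲ` must dominate the `j`-th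
  -- derivative of the exponent. Writing `1 + C` ensures `D ≥ 1`, so that `D ≤ Dʲ`.
  refine ⟨k.factorial * (1 + C) ^ k, M * k, fun i v hv => ?_⟩
  have h1 : 1 ≤ 1 + ‖v‖ := by linarith [norm_nonneg v]
  refine (norm_iteratedFDeriv_comp_le (N := ∞) (g := Complex.exp) (n := k)
    (C := Real.exp (-κ * ‖v‖ ^ 2)) (D := (1 + C) * (1 + ‖v‖) ^ M)
    Complex.contDiff_exp (hf i) (by exact_mod_cast le_top) v ?_ ?_).trans (le_of_eq ?_)
  · intro j _
    refine (norm_iteratedFDeriv_cexp_le j _).trans ?_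
    rw [Complex.norm_exp]
    exact Real.exp_le_exp.2 (he i v hv)
  · intro j hj hjk
    have h2 : 1 ≤ (1 + C) * (1 + ‖v‖) ^ M :=
      one_le_mul_of_one_le_of_one_le (by linarith) (one_le_pow₀ h1)
    refine le_trans ?_ (le_self_pow₀ h2 (by omega))
    have := hC j hjk hj i v hv
    simp only [neg_zero, zero_mul, Real.exp_zero, mul_one] at this
    refine this.trans ?_
    gcongr
    linarith
  · rw [mul_pow, ← pow_mul]
    ring

/-- Since `1 + s ≤ eˢ`, it suffices to maximise `Ms - δs²`, whose maximum is `M²/(4δ)`. -/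
theorem one_add_pow_mul_exp_le (M : ℕ) {δ : ℝ} (hδ : 0 < δ) {s : ℝ} (hs : 0 ≤ s) :
    (1 + s) ^ M * Real.exp (-δ * s ^ 2) ≤ Real.exp (M ^ 2 / (4 * δ)) := by
  have h1 : (1 + s) ^ M ≤ Real.exp (M * s) := by
    rw [Real.exp_nat_mul]
    gcongr
    linarith [Real.add_one_le_exp s]
  refine (mul_le_mul_of_nonneg_right h1 (Real.exp_nonneg _)).trans ?_
  rw [← Real.exp_add, Real.exp_le_exp, le_div_iff₀ (by positivity)]
  nlinarith [sq_nonneg (M - 2 * δ * s)]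

theorem GaussGrowth.absorb {κ κ' : ℝ} (hκ : κ' < κ) {f : ι → E n → ℂ}
    (h : GaussGrowth κ (fun _ => univ) f) (k : ℕ) :
    ∃ C : ℝ, 0 ≤ C ∧ ∀ j ≤ k, ∀ i v,
      ‖iteratedFDeriv ℝ j (f i) v‖ ≤ C * Real.exp (-κ' * ‖v‖ ^ 2) := by
  obtain ⟨C, M, hC0, hC⟩ := h.uniform k
  refine ⟨C * Real.exp (M ^ 2 / (4 * (κ - κ'))), by positivity, fun j hj i v => ?_⟩
  refine (hC j hj i v (mem_univ _)).trans ?_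
  rw [show -κ * ‖v‖ ^ 2 = -(κ - κ') * ‖v‖ ^ 2 + -κ' * ‖v‖ ^ 2 by ring, Real.exp_add, ← mul_assoc,
    mul_assoc C]
  gcongr
  exact one_add_pow_mul_exp_le M (by linarith) (norm_nonneg v)

end

/-! ### Gaussian integrals and correlation of profiles -/

section


variable {n : ℕ}

theorem integrable_gaussian {κ : ℝ} (hκ : 0 < κ) :
    Integrable fun v : E n => Real.exp (-κ * ‖v‖ ^ 2) := by
  have h := GaussianFourier.integrable_cexp_neg_mul_sq_norm_add (V := E n) (b := (κ : ℂ))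
    (by simpa using hκ) 0 0
  refine h.norm.congr (Filter.Eventually.of_forall fun v => ?_)
  simp [Complex.norm_exp, ← Complex.ofReal_pow]

theorem integrable_comp_scale {F : Type} [NormedAddCommGroup F] {r : ℝ} (hr : 0 < r) (x : E n)
    {g : E n → F} (hg : Integrable g) : Integrable fun y : E n => g (r⁻¹ • (y - x)) :=
  (hg.comp_smul (inv_ne_zero hr.ne')).comp_sub_right x

theorem integral_comp_scale {F : Type} [NormedAddCommGroup F] [NormedSpace ℝ F] {r : ℝ}
    (hr : 0 < r) (x : E n) (g : E n → F) :
    ∫ y : E n, g (r⁻¹ • (y - x)) = r ^ n • ∫ v, g v := by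
  rw [integral_sub_right_eq_self (fun y => g (r⁻¹ • y)), Measure.integral_comp_inv_smul_of_nonneg _ _ hr.le]
  simp

/-- The Fourier transform of a product of two wave packet profiles decays in the distance of their
centres and in the frequency. -/
theorem exists_profile_correlation_bound {κ : ℝ} (hκ : 0 < κ) {C : ℝ} (hC : 0 ≤ C) :
    ∃ B : ℝ, 0 ≤ B ∧ ∀ a b : E n → ℂ, ContDiff ℝ ∞ a → ContDiff ℝ ∞ b →
      (∀ j ≤ n + 1, ∀ v, ‖iteratedFDeriv ℝ j a v‖ ≤ C * Real.exp (-κ * ‖v‖ ^ 2)) →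
      (∀ j ≤ n + 1, ∀ v, ‖iteratedFDeriv ℝ j b v‖ ≤ C * Real.exp (-κ * ‖v‖ ^ 2)) →
      ∀ δ q : E n, (1 + ‖δ‖ + ‖q‖) ^ (n + 1) *
        ‖∫ v, a v * (starRingEnd ℂ) (b (v - δ)) * Complex.exp (Complex.I * (inner ℝ q v : ℝ))‖
          ≤ B := by
  set N := n + 1 with hN
  set Γ : ℝ := ∫ v : E n, Real.exp (-(κ / 2) * ‖v‖ ^ 2) with hΓ
  have hΓ0 : 0 ≤ Γ := integral_nonneg fun v => Real.exp_nonneg _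
  set Q : ℝ := 2 ^ N * C ^ 2 * Γ
  refine ⟨Real.exp (N ^ 2 / (4 * (κ / 4))) *
    (2 ^ N * (Q + (2 * Real.pi) ^ N * (2 ^ N * ((N + 1 : ℕ) * Q)))),
    by positivity, fun a b ha hb hab hbb δ q => ?_⟩
  set A : E n → ℂ := fun v => a v * (starRingEnd ℂ) (b (v - δ)) with hA
  have hb' : ContDiff ℝ ∞ fun v => (starRingEnd ℂ) (b (v - δ)) :=
    Complex.conjLIE.contDiff.comp (hb.comp (contDiff_id.sub contDiff_const))
  have hAs : ContDiff ℝ ∞ A := ha.mul hb'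
  have hbd : ∀ j v, ‖iteratedFDeriv ℝ j (fun v => (starRingEnd ℂ) (b (v - δ))) v‖
      = ‖iteratedFDeriv ℝ j b (v - δ)‖ := by
    intro j v
    rw [← iteratedFDeriv_comp_sub j δ v]
    exact Complex.conjLIE.norm_iteratedFDeriv_comp_left (fun v => b (v - δ)) v j
  have hAb : ∀ j ≤ N, ∀ v, ‖iteratedFDeriv ℝ j A v‖ ≤
      (2 ^ N * C ^ 2 * Real.exp (-(κ / 4) * ‖δ‖ ^ 2)) * Real.exp (-(κ / 2) * ‖v‖ ^ 2) := by
    intro j hj v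
    refine (norm_iteratedFDeriv_mul_le (N := ∞) ha hb' v (by exact_mod_cast le_top)).trans ?_
    -- Since `|δ|² ≤ 2|v|² + 2|v - δ|²`, a quarter of the rate pays for decay in `δ` and half of it
    -- remains for integrability in `v`.
    have hexp : Real.exp (-κ * ‖v‖ ^ 2) * Real.exp (-κ * ‖v - δ‖ ^ 2) ≤
        Real.exp (-(κ / 4) * ‖δ‖ ^ 2) * Real.exp (-(κ / 2) * ‖v‖ ^ 2) := by
      rw [← Real.exp_add, ← Real.exp_add, Real.exp_le_exp]
      have h1 : ‖δ‖ ≤ ‖v‖ + ‖v - δ‖ := by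
        calc ‖δ‖ = ‖v - (v - δ)‖ := by simp
          _ ≤ _ := norm_sub_le _ _
      have h2 : ‖δ‖ ^ 2 ≤ 2 * ‖v‖ ^ 2 + 2 * ‖v - δ‖ ^ 2 := by
        nlinarith [norm_nonneg δ, sq_nonneg (‖v‖ - ‖v - δ‖)]
      nlinarith [sq_nonneg ‖v - δ‖, mul_le_mul_of_nonneg_left h2 hκ.le]
    calc _ ≤ ∑ i ∈ Finset.range (j + 1), (j.choose i : ℝ) *
          (C * Real.exp (-κ * ‖v‖ ^ 2)) * (C * Real.exp (-κ * ‖v - δ‖ ^ 2)) := by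
          refine Finset.sum_le_sum fun i hi => ?_
          have hi' := Finset.mem_range.1 hi
          rw [hbd]
          gcongr
          · exact hab i (by omega) v
          · exact hbb (j - i) (by omega) _
      _ = 2 ^ j * C ^ 2 * (Real.exp (-κ * ‖v‖ ^ 2) * Real.exp (-κ * ‖v - δ‖ ^ 2)) := by
          rw [← Finset.sum_mul, ← Finset.sum_mul, ← Nat.cast_sum, Nat.sum_range_choose]
          push_cast
          ring
      _ ≤ 2 ^ N * C ^ 2 * (Real.exp (-(κ / 4) * ‖δ‖ ^ 2) * Real.exp (-(κ / 2) * ‖v‖ ^ 2)) := by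
          gcongr
          norm_num
      _ = _ := by ring
  have hint : ∀ j ≤ N, Integrable fun v => ‖iteratedFDeriv ℝ j A v‖ := by
    intro j hj
    refine ((integrable_gaussian (n := n) (half_pos hκ)).const_mul
      (2 ^ N * C ^ 2 * Real.exp (-(κ / 4) * ‖δ‖ ^ 2))).mono' ?_
      (Filter.Eventually.of_forall fun v => by simpa using hAb j hj v)
    exact (hAs.continuous_iteratedFDeriv (by exact_mod_cast le_top)).norm.aestronglyMeasurable
  set e : ℝ := Real.exp (-(κ / 4) * ‖δ‖ ^ 2)
  have hI : ∀ j ≤ N, ∫ v, ‖iteratedFDeriv ℝ j A v‖ ≤ Q * e := by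
    intro j hj
    calc _ ≤ ∫ v : E n, (2 ^ N * C ^ 2 * e) * Real.exp (-(κ / 2) * ‖v‖ ^ 2) :=
          integral_mono (hint j hj) ((integrable_gaussian (half_pos hκ)).const_mul _) (hAb j hj)
      _ = _ := by rw [integral_const_mul]; ring
  -- The Fourier transform carries the kernel `e^{-2πi⟨v,w⟩}`, whence the sign and the factor `2π`.
  set w : E n := -(2 * Real.pi)⁻¹ • q with hw
  have hF : ∫ v, a v * (starRingEnd ℂ) (b (v - δ)) * Complex.exp (Complex.I * (inner ℝ q v : ℝ))
      = FourierTransform.fourier A w := by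
    rw [Real.fourier_eq']
    congr 1
    funext v
    rw [smul_eq_mul, mul_comm, hw, inner_smul_right, real_inner_comm]
    congr 2
    rw [mul_comm]
    congr 2
    field_simp
  rw [hF]
  have hqw : ‖q‖ = 2 * Real.pi * ‖w‖ := by
    rw [hw, norm_smul, norm_neg, norm_inv, Real.norm_of_nonneg (by positivity)]
    field_simp
  -- Integration by parts `m` times; only `m = 0` and `m = N` are used.
  have hfour : ∀ m ≤ N, ‖w‖ ^ m * ‖FourierTransform.fourier A w‖ ≤ 2 ^ m * ((m + 1 : ℕ) * (Q * e)) := by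
    intro m hm
    have := Real.pow_mul_norm_iteratedFDeriv_fourier_le (K := 0) (N := N) (f := A)
      (hAs.of_le (by exact_mod_cast le_top)) (fun k j hk hj => by
        have hk0 : k = 0 := by simpa using hk
        subst hk0
        simpa using hint j (by exact_mod_cast hj)) (k := 0) (n := m) (by simp)
        (by exact_mod_cast hm) w
    rw [norm_iteratedFDeriv_zero] at this
    refine this.trans ?_
    simp only [pow_zero, one_mul, CharP.cast_eq_zero, mul_zero, zero_add, Finset.range_one]
    gcongr
    rw [Finset.sum_product]
    simp only [Finset.sum_singleton, pow_zero, one_mul]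
    calc _ ≤ ∑ j ∈ Finset.range (m + 1), Q * e := Finset.sum_le_sum fun j hj =>
          hI j (by have := Finset.mem_range.1 hj; omega)
      _ = _ := by simp
  set J := ‖FourierTransform.fourier A w‖
  have hJ0 : J ≤ Q * e := by simpa using hfour 0 (Nat.zero_le _)
  have hJN : ‖q‖ ^ N * J ≤ (2 * Real.pi) ^ N * (2 ^ N * ((N + 1 : ℕ) * (Q * e))) := by
    rw [hqw, mul_pow, mul_assoc]
    exact mul_le_mul_of_nonneg_left (hfour N le_rfl) (by positivity)
  have hJ : 0 ≤ J := norm_nonneg _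
  have hδe : (1 + ‖δ‖) ^ N * e ≤ Real.exp (N ^ 2 / (4 * (κ / 4))) :=
    one_add_pow_mul_exp_le N (by positivity) (norm_nonneg δ)
  -- The weight splits into a factor in `δ`, absorbed by the Gaussian `e`, and a factor in `q`,
  -- absorbed by the Fourier decay.
  calc (1 + ‖δ‖ + ‖q‖) ^ N * J ≤ ((1 + ‖δ‖) * (1 + ‖q‖)) ^ N * J := by
        gcongr
        nlinarith [norm_nonneg δ, norm_nonneg q, mul_nonneg (norm_nonneg δ) (norm_nonneg q)]
    _ = (1 + ‖δ‖) ^ N * ((1 + ‖q‖) ^ N * J) := by rw [mul_pow, mul_assoc]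
    _ ≤ (1 + ‖δ‖) ^ N * (2 ^ N * (1 + ‖q‖ ^ N) * J) := by
        gcongr
        refine (add_pow_le zero_le_one (norm_nonneg q) N).trans ?_
        rw [one_pow]
        gcongr
        · norm_num
        · omega
    _ = (1 + ‖δ‖) ^ N * (2 ^ N * (J + ‖q‖ ^ N * J)) := by ring
    _ ≤ (1 + ‖δ‖) ^ N *
        (2 ^ N * (Q * e + (2 * Real.pi) ^ N * (2 ^ N * ((N + 1 : ℕ) * (Q * e))))) := by gcongr
    _ = ((1 + ‖δ‖) ^ N * e) *
        (2 ^ N * (Q + (2 * Real.pi) ^ N * (2 ^ N * ((N + 1 : ℕ) * Q)))) := by ring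
    _ ≤ _ := by gcongr

end

/-! ### Wave packets and almost orthogonality -/

section


variable {n : ℕ}

/-- The wave packet with centre `x`, momentum `p`, scale `r` and profile `a`. -/
def packet (r : ℝ) (x p : E n) (a : E n → ℂ) (y : E n) : ℂ :=
  Complex.exp (Complex.I * (inner ℝ p (y - x) : ℝ) / (r : ℂ) ^ 2) * a (r⁻¹ • (y - x))

theorem norm_packet (r : ℝ) (x p : E n) (a : E n → ℂ) (y : E n) :
    ‖packet r x p a y‖ = ‖a (r⁻¹ • (y - x))‖ := by
  have : Complex.I * (inner ℝ p (y - x) : ℝ) / (r : ℂ) ^ 2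
      = ((inner ℝ p (y - x) / r ^ 2 : ℝ) : ℂ) * Complex.I := by
    push_cast; ring
  rw [packet, norm_mul, this, Complex.norm_exp_ofReal_mul_I, one_mul]

/-- In the variable `v = (y - x)/r` the two linear phases combine into frequency `(p - p')/r`;
recentring the second packet leaves only a unimodular constant. -/
theorem packet_mul_conj {r : ℝ} (hr : 0 < r) (x p x' p' : E n) (a a' : E n → ℂ) (y : E n) :
    packet r x p a y * (starRingEnd ℂ) (packet r x' p' a' y)
      = Complex.exp (-(Complex.I * (inner ℝ p' (x - x') : ℝ) / (r : ℂ) ^ 2)) *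
        (fun v => a v * (starRingEnd ℂ) (a' (v - r⁻¹ • (x' - x))) *
          Complex.exp (Complex.I * (inner ℝ (r⁻¹ • (p - p')) v : ℝ))) (r⁻¹ • (y - x)) := by
  have h1 : r⁻¹ • (y - x) - r⁻¹ • (x' - x) = r⁻¹ • (y - x') := by
    rw [← smul_sub]; congr 1; abel
  simp only [packet, map_mul, ← Complex.exp_conj, h1]
  have hr' : (r : ℂ) ≠ 0 := by exact_mod_cast hr.ne'
  have h2 : Complex.exp (Complex.I * (inner ℝ p (y - x) : ℝ) / (r : ℂ) ^ 2) *
      Complex.exp ((starRingEnd ℂ) (Complex.I * (inner ℝ p' (y - x') : ℝ) / (r : ℂ) ^ 2))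
      = Complex.exp (-(Complex.I * (inner ℝ p' (x - x') : ℝ) / (r : ℂ) ^ 2)) *
        Complex.exp (Complex.I * (inner ℝ (r⁻¹ • (p - p')) (r⁻¹ • (y - x)) : ℝ)) := by
    rw [← Complex.exp_add, ← Complex.exp_add]
    congr 1
    have h3 : inner ℝ p' (y - x') = inner ℝ p' (y - x) + inner ℝ p' (x - x') := by
      rw [← inner_add_right]; congr 1; abel
    rw [h3, real_inner_smul_left, real_inner_smul_right, inner_sub_left]
    simp only [map_div₀, map_mul, Complex.conj_I, Complex.conj_ofReal, map_pow]
    push_cast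
    field_simp
    ring
  linear_combination (a (r⁻¹ • (y - x)) * (starRingEnd ℂ) (a' (r⁻¹ • (y - x')))) * h2

/-- Almost orthogonality of wave packets that are separated in phase space. -/
theorem exists_packet_correlation_bound {κ : ℝ} (hκ : 0 < κ) {C : ℝ} (hC : 0 ≤ C) :
    ∃ B : ℝ, 0 ≤ B ∧ ∀ a b : E n → ℂ, ContDiff ℝ ∞ a → ContDiff ℝ ∞ b →
      (∀ j ≤ n + 1, ∀ v, ‖iteratedFDeriv ℝ j a v‖ ≤ C * Real.exp (-κ * ‖v‖ ^ 2)) →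
      (∀ j ≤ n + 1, ∀ v, ‖iteratedFDeriv ℝ j b v‖ ≤ C * Real.exp (-κ * ‖v‖ ^ 2)) →
      ∀ r : ℝ, 0 < r → ∀ x p x' p' : E n, ∀ d : ℝ, 0 ≤ d → d ≤ ‖p - p'‖ + ‖x - x'‖ →
        ‖∫ y, packet r x p a y * (starRingEnd ℂ) (packet r x' p' b y)‖
          ≤ r ^ n * (B * (1 + r⁻¹ * d) ^ (-((n + 1 : ℕ) : ℝ))) := by
  obtain ⟨B, hB0, hB⟩ := exists_profile_correlation_bound (n := n) hκ hC
  refine ⟨B, hB0, fun a b ha hb hab hbb r hr x p x' p' d hd0 hd => ?_⟩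
  rw [integral_congr_ae (Filter.Eventually.of_forall (packet_mul_conj hr x p x' p' a b)),
    integral_const_mul, integral_comp_scale hr x (fun v => a v *
      (starRingEnd ℂ) (b (v - r⁻¹ • (x' - x))) *
        Complex.exp (Complex.I * (inner ℝ (r⁻¹ • (p - p')) v : ℝ))), norm_mul, norm_smul, norm_pow,
    Real.norm_of_nonneg hr.le]
  have h1 : ‖Complex.exp (-(Complex.I * (inner ℝ p' (x - x') : ℝ) / (r : ℂ) ^ 2))‖ = 1 := by
    have : -(Complex.I * (inner ℝ p' (x - x') : ℝ) / (r : ℂ) ^ 2)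
        = ((-(inner ℝ p' (x - x') / r ^ 2) : ℝ) : ℂ) * Complex.I := by
      push_cast; ring
    rw [this, Complex.norm_exp_ofReal_mul_I]
  rw [h1, one_mul]
  gcongr
  have hpos : 0 < 1 + r⁻¹ * d := by positivity
  rw [Real.rpow_neg hpos.le, Real.rpow_natCast, ← div_eq_mul_inv, le_div_iff₀ (by positivity),
    mul_comm]
  refine le_trans ?_ (hB a b ha hb hab hbb (r⁻¹ • (x' - x)) (r⁻¹ • (p - p')))
  refine mul_le_mul_of_nonneg_right (pow_le_pow_left₀ hpos.le ?_ _) (norm_nonneg _)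
  rw [norm_smul, norm_smul, Real.norm_of_nonneg (inv_nonneg.2 hr.le), norm_sub_rev x' x, add_assoc,
    ← mul_add]
  gcongr
  linarith

/-- The square of the `L²` norm of an integral of functions is bounded by the integral of their
correlations. -/
theorem eLpNorm_integral_le_of_correlation {X Y : Type} [MeasurableSpace X] [MeasurableSpace Y]
    {μ : Measure X} {ν : Measure Y} [SFinite μ] [SFinite ν] {f : X → Y → ℂ} {k : X × X → ℝ}
    (hΨ : Integrable (fun q : (X × X) × Y => f q.1.1 q.2 * (starRingEnd ℂ) (f q.1.2 q.2))
      ((μ.prod μ).prod ν))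
    (hk : Integrable k (μ.prod μ))
    (hfk : ∀ᵐ q ∂(μ.prod μ), ‖∫ y, f q.1 y * (starRingEnd ℂ) (f q.2 y) ∂ν‖ ≤ k q) {b : ℝ}
    (hb : 0 ≤ b) (hkb : ∫ q, k q ∂(μ.prod μ) ≤ b ^ 2) :
    eLpNorm (fun y => ∫ z, f z y ∂μ) 2 ν ≤ ENNReal.ofReal b := by
  set Ψ : X × X → Y → ℂ := fun q y => f q.1 y * (starRingEnd ℂ) (f q.2 y) with hΨdef
  replace hΨ : Integrable (Function.uncurry Ψ) ((μ.prod μ).prod ν) := hΨ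
  set J : Y → ℂ := fun y => ∫ z, f z y ∂μ with hJ
  -- The squared modulus of an integral is the double integral of `f(z) · conj f(z')`.
  have hJsq : ∀ y, ∫ q, Ψ q y ∂(μ.prod μ) = ((‖J y‖ ^ 2 : ℝ) : ℂ) := by
    intro y
    have := integral_prod_mul (μ := μ) (ν := μ) (fun z => f z y)
      (fun z => (starRingEnd ℂ) (f z y))
    rw [integral_conj, Complex.mul_conj'] at this
    rw [hΨdef, this]
    simp [hJ]
  have hJint : Integrable (fun y => ‖J y‖ ^ 2) ν := by
    refine hΨ.integral_prod_right.norm.congr (Filter.Eventually.of_forall fun y => ?_)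
    simp only [Function.uncurry_apply_pair, hJsq]
    rw [Complex.norm_real, Real.norm_of_nonneg (by positivity)]
  have hmain : ∫ y, ‖J y‖ ^ 2 ∂ν ≤ b ^ 2 := by
    have h1 : ((∫ y, ‖J y‖ ^ 2 ∂ν : ℝ) : ℂ) = ∫ q, (∫ y, Ψ q y ∂ν) ∂(μ.prod μ) := by
      rw [integral_integral_swap hΨ, ← integral_complex_ofReal]
      simp only [hJsq]
    have h2 : ∫ y, ‖J y‖ ^ 2 ∂ν = ‖∫ q, (∫ y, Ψ q y ∂ν) ∂(μ.prod μ)‖ := by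
      rw [← h1, Complex.norm_real, Real.norm_of_nonneg (integral_nonneg fun y => by positivity)]
    rw [h2]
    exact (norm_integral_le_of_norm_le hk hfk).trans hkb
  rw [eLpNorm_eq_lintegral_rpow_enorm_toReal (by simp) (by simp)]
  simp only [ENNReal.toReal_ofNat, ENNReal.rpow_ofNat]
  have h3 : ∫⁻ y, ‖J y‖ₑ ^ 2 ∂ν = ENNReal.ofReal (∫ y, ‖J y‖ ^ 2 ∂ν) := by
    rw [ofReal_integral_eq_lintegral_ofReal hJint
      (Filter.Eventually.of_forall fun y => by positivity)]
    refine lintegral_congr fun y => ?_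
    rw [ENNReal.ofReal_pow (norm_nonneg _), ofReal_norm]
  rw [h3]
  calc ENNReal.ofReal (∫ y, ‖J y‖ ^ 2 ∂ν) ^ (1 / 2 : ℝ)
      ≤ ENNReal.ofReal (b ^ 2) ^ (1 / 2 : ℝ) := by gcongr
    _ = _ := by
        rw [ENNReal.ofReal_rpow_of_nonneg (by positivity) (by norm_num), ← Real.sqrt_eq_rpow,
          Real.sqrt_sq hb]

theorem ae_prod_restrict_mem {K : Set (E n)} (hKm : MeasurableSet K) :
    ∀ᵐ q ∂(((volume : Measure (E n)).restrict K).prod ((volume : Measure (E n)).restrict K)),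
      q.1 ∈ K ∧ q.2 ∈ K := by
  rw [Measure.prod_restrict]
  exact (ae_restrict_iff' (hKm.prod hKm)).2 (Filter.Eventually.of_forall fun q hq => hq)

/-- Products of functions that are dominated by translated Gaussians are integrable. -/
theorem integrable_correlation {K : Set (E n)} (hK : IsCompact K) {κ : ℝ} (hκ : 0 < κ) {C r : ℝ}
    (hC : 0 ≤ C) (hr : 0 < r) {x : E n → E n} {f : E n → E n → ℂ}
    (hcont : ContinuousOn (fun q : E n × E n => f q.1 q.2) (K ×ˢ univ))
    (hfb : ∀ z ∈ K, ∀ y, ‖f z y‖ ≤ C * Real.exp (-κ * ‖r⁻¹ • (y - x z)‖ ^ 2)) :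
    Integrable (fun q : (E n × E n) × E n => f q.1.1 q.2 * (starRingEnd ℂ) (f q.1.2 q.2))
      (((volume.restrict K).prod (volume.restrict K)).prod volume) := by
  have hKm := hK.measurableSet
  have : IsFiniteMeasure ((volume : Measure (E n)).restrict K) :=
    ⟨by simpa using hK.measure_lt_top⟩
  have hmem := ae_prod_restrict_mem hKm
  have hfb' : ∀ z ∈ K, ∀ y, ‖f z y‖ ≤ C := by
    intro z hz y
    refine (hfb z hz y).trans (mul_le_of_le_one_right hC (Real.exp_le_one_iff.2 ?_))
    nlinarith [sq_nonneg ‖r⁻¹ • (y - x z)‖]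
  have hm : AEStronglyMeasurable
      (fun q : (E n × E n) × E n => f q.1.1 q.2 * (starRingEnd ℂ) (f q.1.2 q.2))
      (((volume.restrict K).prod (volume.restrict K)).prod volume) := by
    have hm : (((volume : Measure (E n)).restrict K).prod ((volume : Measure (E n)).restrict K)).prod
        (volume : Measure (E n))
        = (((volume : Measure (E n)).prod volume).prod volume).restrict ((K ×ˢ K) ×ˢ univ) := by
      rw [← Measure.prod_restrict, Measure.restrict_univ, Measure.prod_restrict]
    rw [hm]
    refine ContinuousOn.aestronglyMeasurable ?_ ((hKm.prod hKm).prod MeasurableSet.univ)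
    have h1 : ContinuousOn (fun q : (E n × E n) × E n => f q.1.1 q.2) ((K ×ˢ K) ×ˢ univ) :=
      hcont.comp (f := fun q : (E n × E n) × E n => (q.1.1, q.2)) (by fun_prop)
        fun q hq => ⟨hq.1.1, mem_univ _⟩
    have h2 : ContinuousOn (fun q : (E n × E n) × E n => f q.1.2 q.2) ((K ×ˢ K) ×ˢ univ) :=
      hcont.comp (f := fun q : (E n × E n) × E n => (q.1.2, q.2)) (by fun_prop)
        fun q hq => ⟨hq.1.2, mem_univ _⟩
    exact h1.mul (Complex.continuous_conj.comp_continuousOn h2)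
  have hdom : ∀ q : E n × E n, q.1 ∈ K ∧ q.2 ∈ K → ∀ y,
      ‖f q.1 y * (starRingEnd ℂ) (f q.2 y)‖
        ≤ C * C * Real.exp (-κ * ‖r⁻¹ • (y - x q.1)‖ ^ 2) := by
    intro q hq y
    simp only [norm_mul, RCLike.norm_conj]
    calc _ ≤ (C * Real.exp (-κ * ‖r⁻¹ • (y - x q.1)‖ ^ 2)) * C := by
          gcongr
          · exact hfb _ hq.1 y
          · exact hfb' _ hq.2 y
      _ = _ := by ring
  have hdomint : ∀ z : E n, Integrable fun y : E n =>
      C * C * Real.exp (-κ * ‖r⁻¹ • (y - x z)‖ ^ 2) := fun z =>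
    (integrable_comp_scale hr (x z) (integrable_gaussian hκ)).const_mul _
  rw [integrable_prod_iff hm]
  constructor
  · filter_upwards [hmem, hm.prodMk_left] with q hq hqm
    exact (hdomint q.1).mono' hqm (Filter.Eventually.of_forall (hdom q hq))
  -- The integral over `y` is bounded independently of the pair of centres, and `K × K` has finite
  -- measure.
  · refine (integrable_const
      (C * C * (r ^ n * ∫ v : E n, Real.exp (-κ * ‖v‖ ^ 2)))).mono'
      hm.norm.integral_prod_right' ?_
    filter_upwards [hmem] with q hq
    rw [Real.norm_of_nonneg (integral_nonneg fun y => norm_nonneg _)]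
    calc ∫ y, ‖f q.1 y * (starRingEnd ℂ) (f q.2 y)‖
        ≤ ∫ y, C * C * Real.exp (-κ * ‖r⁻¹ • (y - x q.1)‖ ^ 2) :=
          integral_mono_of_nonneg (Filter.Eventually.of_forall fun y => norm_nonneg _)
            (hdomint q.1) (Filter.Eventually.of_forall (hdom q hq))
      _ = _ := by
          rw [integral_const_mul,
            integral_comp_scale hr (x q.1) (fun v => Real.exp (-κ * ‖v‖ ^ 2)), smul_eq_mul]

/-- The decay kernel at scale `r` has mass of order `rⁿ`. -/
theorem integral_decay_kernel_le {K : Set (E n)} (hK : IsCompact K) {r c : ℝ} (hr : 0 < r)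
    (hc : 0 < c) :
    Integrable (fun q : E n × E n => (1 + r⁻¹ * (c * ‖q.1 - q.2‖)) ^ (-((n + 1 : ℕ) : ℝ)))
      ((volume.restrict K).prod (volume.restrict K)) ∧
    ∫ q, (1 + r⁻¹ * (c * ‖q.1 - q.2‖)) ^ (-((n + 1 : ℕ) : ℝ))
        ∂((volume.restrict K).prod ((volume : Measure (E n)).restrict K))
      ≤ volume.real K *
        ((r * c⁻¹) ^ n * ∫ v : E n, (1 + ‖v‖) ^ (-((n + 1 : ℕ) : ℝ))) := by
  have : IsFiniteMeasure ((volume : Measure (E n)).restrict K) :=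
    ⟨by simpa using hK.measure_lt_top⟩
  have hk1 : ∀ q : E n × E n, 1 ≤ 1 + r⁻¹ * (c * ‖q.1 - q.2‖) := fun q => by
    have : 0 ≤ r⁻¹ * (c * ‖q.1 - q.2‖) := by positivity
    linarith
  have hk0 : ∀ q : E n × E n, 0 ≤ (1 + r⁻¹ * (c * ‖q.1 - q.2‖)) ^ (-((n + 1 : ℕ) : ℝ)) :=
    fun q => Real.rpow_nonneg (by linarith [hk1 q]) _
  have hint : Integrable
      (fun q : E n × E n => (1 + r⁻¹ * (c * ‖q.1 - q.2‖)) ^ (-((n + 1 : ℕ) : ℝ)))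
      ((volume.restrict K).prod (volume.restrict K)) := by
    refine (integrable_const (1 : ℝ)).mono' (Continuous.aestronglyMeasurable ?_)
      (Filter.Eventually.of_forall fun q => ?_)
    · exact Continuous.rpow_const (by fun_prop) fun q => Or.inl (by linarith [hk1 q])
    · rw [Real.norm_of_nonneg (hk0 q)]
      exact Real.rpow_le_one_of_one_le_of_nonpos (hk1 q) (neg_nonpos.2 (Nat.cast_nonneg _))
  refine ⟨hint, ?_⟩
  have hrc : 0 < r * c⁻¹ := by positivity
  -- The kernel is a function of `z' - z` rescaled by `r/c`; the change of variables gives `(r/c)ⁿ`,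
  -- and the exponent `n + 1 > n` makes the integral converge.
  have he : ∀ z z' : E n, 1 + r⁻¹ * (c * ‖z - z'‖) = 1 + ‖(r * c⁻¹)⁻¹ • (z' - z)‖ := by
    intro z z'
    rw [norm_smul, Real.norm_of_nonneg (inv_nonneg.2 hrc.le), norm_sub_rev, mul_inv, inv_inv,
      mul_assoc]
  have hΓint : Integrable fun v : E n => (1 + ‖v‖) ^ (-((n + 1 : ℕ) : ℝ)) :=
    integrable_one_add_norm (by simp)
  have hz : ∀ z : E n, ∫ z' in K, (1 + r⁻¹ * (c * ‖z - z'‖)) ^ (-((n + 1 : ℕ) : ℝ))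
      ≤ (r * c⁻¹) ^ n * ∫ v : E n, (1 + ‖v‖) ^ (-((n + 1 : ℕ) : ℝ)) := by
    intro z
    rw [← smul_eq_mul, ← integral_comp_scale hrc z (fun v => (1 + ‖v‖) ^ (-((n + 1 : ℕ) : ℝ)))]
    simp only [he]
    exact setIntegral_le_integral (integrable_comp_scale hrc z hΓint)
      (Filter.Eventually.of_forall fun z' => Real.rpow_nonneg (by positivity) _)
  rw [integral_prod _ hint]
  refine (integral_mono hint.integral_prod_left (integrable_const _) hz).trans ?_
  simp [Measure.real]

end

/-! ### Superpositions of wave packets -/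

section


variable {n : ℕ}

/-- Superpositions of wave packets that are uniformly separated in phase space are bounded in
`L²`. -/
theorem exists_superposition_bound {K : Set (E n)} (hK : IsCompact K) {κ : ℝ} (hκ : 0 < κ) {C c : ℝ}
    (hC : 0 ≤ C) (hc : 0 < c) :
    ∃ B : ℝ, 0 ≤ B ∧ ∀ (r : ℝ) (x p : E n → E n) (a : E n → E n → ℂ), 0 < r →
      ContinuousOn (fun q : E n × E n => packet r (x q.1) (p q.1) (a q.1) q.2) (K ×ˢ univ) →
      (∀ z ∈ K, ContDiff ℝ ∞ (a z)) →
      (∀ z ∈ K, ∀ j ≤ n + 1, ∀ v, ‖iteratedFDeriv ℝ j (a z) v‖ ≤ C * Real.exp (-κ * ‖v‖ ^ 2)) →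
      (∀ z ∈ K, ∀ z' ∈ K, c * ‖z - z'‖ ≤ ‖p z - p z'‖ + ‖x z - x z'‖) →
      eLpNorm (fun y => ∫ z in K, packet r (x z) (p z) (a z) y) 2 volume
        ≤ ENNReal.ofReal (B * r ^ n) := by
  obtain ⟨B, hB0, hB⟩ := exists_packet_correlation_bound (n := n) hκ hC
  set Γ : ℝ := ∫ v : E n, (1 + ‖v‖) ^ (-((n + 1 : ℕ) : ℝ)) with hΓ
  have hΓ0 : 0 ≤ Γ := integral_nonneg fun v => by positivity
  -- The correlation bound and the kernel mass each contribute `rⁿ`, so the squared norm is this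
  -- radicand times `r^{2n}`.
  refine ⟨√(B * (c⁻¹ ^ n * Γ) * volume.real K), Real.sqrt_nonneg _,
    fun r x p a hr hcont has hab hsep => ?_⟩
  obtain ⟨hkint, hkle⟩ := integral_decay_kernel_le hK hr hc
  set f : E n → E n → ℂ := fun z y => packet r (x z) (p z) (a z) y with hf
  have hcorr := integrable_correlation hK hκ hC hr (f := f) hcont (x := x) fun z hz y => by
    rw [hf, norm_packet]
    simpa using hab z hz 0 (Nat.zero_le _) (r⁻¹ • (y - x z))
  have hker : ∀ᵐ q ∂((volume.restrict K).prod ((volume : Measure (E n)).restrict K)),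
      ‖∫ y, f q.1 y * (starRingEnd ℂ) (f q.2 y)‖
        ≤ r ^ n * (B * (1 + r⁻¹ * (c * ‖q.1 - q.2‖)) ^ (-((n + 1 : ℕ) : ℝ))) := by
    filter_upwards [ae_prod_restrict_mem hK.measurableSet] with q hq
    exact hB (a q.1) (a q.2) (has _ hq.1) (has _ hq.2) (hab _ hq.1) (hab _ hq.2) r hr
      (x q.1) (p q.1) (x q.2) (p q.2) (c * ‖q.1 - q.2‖) (by positivity) (hsep _ hq.1 _ hq.2)
  refine eLpNorm_integral_le_of_correlation hcorr ((hkint.const_mul B).const_mul (r ^ n)) hker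
    (by positivity) ?_
  rw [integral_const_mul, integral_const_mul, mul_pow, Real.sq_sqrt (by positivity)]
  calc _ ≤ r ^ n * (B * (volume.real K * ((r * c⁻¹) ^ n * Γ))) :=
        mul_le_mul_of_nonneg_left (mul_le_mul_of_nonneg_left hkle hB0) (by positivity)
    _ = _ := by rw [mul_pow]; ring

end

/-! ### Derivatives of packets and the profile of a beam -/

section


variable {n : ℕ} {ι : Type}

theorem contDiff_packet {r : ℝ} {x p : E n} {a : E n → ℂ} (ha : ContDiff ℝ ∞ a) :
    ContDiff ℝ ∞ (packet r x p a) := by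
  have h1 : ContDiff ℝ ∞ fun y : E n => y - x := contDiff_id.sub contDiff_const
  have h2 : ContDiff ℝ ∞ fun y : E n => ((inner ℝ p (y - x) : ℝ) : ℂ) :=
    Complex.ofRealCLM.contDiff.comp (contDiff_const.inner ℝ h1)
  exact ((contDiff_const.mul h2).div_const _).cexp.mul (ha.comp (h1.const_smul _))

/-- A derivative falling on the oscillating factor gives `i pⱼ/r²`; one falling on the profile gives
`1/r = r/r²`. Hence the common factor `r⁻²`. -/
theorem pderiv_packet {r : ℝ} (hr : r ≠ 0) {x p : E n} {a : E n → ℂ} (ha : ContDiff ℝ ∞ a)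
    (j : Fin n) (y : E n) :
    pderiv j (packet r x p a) y = ((r : ℂ) ^ 2)⁻¹ *
      packet r x p (fun v => (r : ℂ) * pderiv j a v + Complex.I * (p j : ℂ) * a v) y := by
  have h0 : HasFDerivAt (fun y : E n => y - x) (ContinuousLinearMap.id ℝ (E n)) y :=
    (hasFDerivAt_id y).sub_const x
  have h1 : HasFDerivAt (fun y : E n => ((inner ℝ p (y - x) : ℝ) : ℂ))
      (Complex.ofRealCLM.comp (innerSL ℝ p)) y :=
    Complex.ofRealCLM.hasFDerivAt.comp y ((innerSL ℝ p).hasFDerivAt.comp y h0)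
  have h2 := ((h1.const_mul Complex.I).mul_const (((r : ℂ) ^ 2)⁻¹)).cexp
  have h3 : HasFDerivAt (fun y : E n => a (r⁻¹ • (y - x)))
      ((fderiv ℝ a (r⁻¹ • (y - x))).comp (r⁻¹ • ContinuousLinearMap.id ℝ (E n))) y :=
    ((ha.differentiable (by simp) _).hasFDerivAt).comp y (h0.const_smul r⁻¹)
  have h4 := (h2.mul h3).fderiv
  have h5 : packet r x p a = (fun y => Complex.exp (Complex.I * ((inner ℝ p (y - x) : ℝ) : ℂ) *
      ((r : ℂ) ^ 2)⁻¹)) * fun y => a (r⁻¹ • (y - x)) := by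
    funext y
    simp [packet, div_eq_mul_inv]
  rw [pderiv, h5, h4]
  have hr' : (r : ℂ) ≠ 0 := by exact_mod_cast hr
  simp [packet, pderiv, div_eq_mul_inv, EuclideanSpace.inner_single_right]
  field_simp

/-- Derivatives of wave packets are wave packets again; each one costs a factor `r⁻²`. -/
theorem exists_partialD_packet {κ B : ℝ} {r : ι → ℝ} {x p : ι → E n} {a : ι → E n → ℂ}
    (hr : ∀ i, 0 < r i) (hr1 : ∀ i, r i ≤ 1) (hp : ∀ i, ‖p i‖ ≤ B)
    (ha : GaussGrowth κ (fun _ => univ) a) (c : ι → ℂ) (β : MultiIndex n) :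
    ∃ a' : ι → E n → ℂ, GaussGrowth κ (fun _ => univ) a' ∧
      ∀ i, partialD β (fun y => c i * packet (r i) (x i) (p i) (a i) y)
        = fun y => c i * (((r i : ℂ) ^ 2)⁻¹) ^ order β * packet (r i) (x i) (p i) (a' i) y := by
  refine partialD_induction (ι := ι) (P := fun m f => ∃ a' : ι → E n → ℂ,
    GaussGrowth κ (fun _ => univ) a' ∧
      ∀ i, f i = fun y => c i * (((r i : ℂ) ^ 2)⁻¹) ^ m * packet (r i) (x i) (p i) (a' i) y)
    ?_ ⟨a, ha, fun i => by simp⟩ β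
  rintro j m f ⟨a', ha', hf⟩
  refine ⟨fun i v => (r i : ℂ) * pderiv j (a' i) v + Complex.I * (p i j : ℂ) * a' i v, ?_, ?_⟩
  · have h1 := (GaussGrowth.const (S := fun _ => univ) (n := n) (c := fun i => (r i : ℂ)) (B := 1)
      fun i => by simpa [abs_of_pos (hr i)] using hr1 i).mul (ha'.pderiv j)
    have h2 := (GaussGrowth.const (S := fun _ => univ) (n := n)
      (c := fun i => Complex.I * (p i j : ℂ)) (B := B) fun i => by
        simpa using (PiLp.norm_apply_le (p i) j).trans (hp i)).mul ha'
    rw [zero_add] at h1 h2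
    exact h1.add h2
  · intro i
    funext y
    have hd : DifferentiableAt ℝ (packet (r i) (x i) (p i) (a' i)) y :=
      (contDiff_packet (ha'.smooth i)).differentiable (by simp) y
    have h1 : pderiv j (f i) y
        = c i * (((r i : ℂ) ^ 2)⁻¹) ^ m * pderiv j (packet (r i) (x i) (p i) (a' i)) y := by
      rw [pderiv, hf i, fderiv_const_mul hd]
      simp [pderiv]
    change pderiv j (f i) y = _
    rw [h1, pderiv_packet (hr i).ne' (ha'.smooth i) j y, pow_succ]
    ring

theorem GaussGrowth.sum {κ : ℝ} {S : ι → Set (E n)} {J : Type} (s : Finset J)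
    {f : J → ι → E n → ℂ} (hf : ∀ j ∈ s, GaussGrowth κ S (f j)) :
    GaussGrowth κ S fun i v => ∑ j ∈ s, f j i v := by
  classical
  induction s using Finset.induction_on with
  | empty =>
    refine ⟨fun i => by simpa using contDiff_const, fun k => ⟨0, 0, fun i v _ => ?_⟩⟩
    simp [iteratedFDeriv_fun_zero]
  | insert j s hj ih =>
    simp only [Finset.sum_insert hj]
    exact (hf j (Finset.mem_insert_self _ _)).add
      (ih fun l hl => hf l (Finset.mem_insert_of_mem hl))

theorem hasTemperateGrowth_monomial (β : MultiIndex n) :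
    Function.HasTemperateGrowth fun y : E n => (monomial β y : ℂ) := by
  have h : ∀ s : Finset (Fin n),
      Function.HasTemperateGrowth fun y : E n => ∏ i ∈ s, ((y i : ℝ) : ℂ) ^ β i := by
    intro s
    induction s using Finset.induction_on with
    | empty => simp
    | insert i s hi ih =>
      simp only [Finset.prod_insert hi]
      have h1 : Function.HasTemperateGrowth fun y : E n => ((y i : ℝ) : ℂ) :=
        (Complex.ofRealCLM.comp (EuclideanSpace.proj i : E n →L[ℝ] ℝ)).hasTemperateGrowth
      exact (h1.pow (β i)).mul ih
  simpa [monomial] using h Finset.univ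

theorem GaussGrowth.of_hasTemperateGrowth {S : ι → Set (E n)} {f : E n → ℂ}
    (hf : f.HasTemperateGrowth) : GaussGrowth 0 S fun _ => f := by
  refine ⟨fun _ => hf.1, fun k => ?_⟩
  obtain ⟨M, C, hC⟩ := hf.2 k
  exact ⟨C, M, fun _ v _ => by simpa using hC v⟩

theorem hasTemperateGrowth_cutoff {η : ℝ≥0∞} {ρ : E n → ℝ} (hρ : IsCutoff η ρ) :
    Function.HasTemperateGrowth fun y : E n => (ρ y : ℂ) := by
  by_cases hη : η = ⊤
  · have : (fun y : E n => (ρ y : ℂ)) = fun _ => 1 := by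
      funext y
      simp [hρ.eq_one y (by simp [hη])]
    rw [this]
    exact Function.HasTemperateGrowth.const 1
  · refine HasCompactSupport.hasTemperateGrowth ?_ (Complex.ofRealCLM.contDiff.comp hρ.smooth)
    refine HasCompactSupport.intro (isCompact_closedBall 0 (2 * η).toReal) fun y hy => ?_
    rw [hρ.eq_zero y, Complex.ofReal_zero]
    rw [mem_closedBall_zero_iff, not_le] at hy
    rw [← ofReal_norm]
    exact (ENNReal.le_ofReal_iff_toReal_le (ENNReal.mul_ne_top (by simp) hη) (norm_nonneg _)).2 hy.le

/-- The profile of a Gaussian beam, after the linear part of its phase has been removed. -/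
theorem gaussGrowth_profile {η : ℝ≥0∞} {ρ : E n → ℝ} (hρ : IsCutoff η ρ) {r : ι → ℝ}
    {x p : ι → E n} {G φ : ι → E n → ℂ} {w : ℝ} (α : MultiIndex n)
    (hr : ∀ i, 0 < r i) (hr1 : ∀ i, r i ≤ 1)
    (hGs : ∀ i, ContDiff ℝ ∞ (G i))
    (hGb : ∀ k, ∃ C : ℝ, ∀ i y, ‖iteratedFDeriv ℝ k (G i) y‖ ≤ C)
    (hφs : ∀ i, ContDiff ℝ ∞ (φ i))
    (hφb : ∀ k, ∃ (C : ℝ) (M : ℕ), ∀ i y, ‖y‖ₑ ≤ 2 * η →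
      ‖iteratedFDeriv ℝ k (φ i) y‖ ≤ C * (1 + ‖y‖) ^ M)
    (hφ0 : ∀ i v, fderiv ℝ (φ i) 0 v = (inner ℝ (p i) v : ℝ))
    (hφw : ∀ i y, ‖y‖ₑ ≤ 2 * η → w * ‖y‖ ^ 2 ≤ (φ i y).im) :
    GaussGrowth w (fun _ => univ) fun i v =>
      G i (x i + r i • v) * (monomial α v : ℂ) *
        Complex.exp (Complex.I * (φ i (r i • v) - (inner ℝ (p i) (r i • v) : ℝ)) / (r i : ℂ) ^ 2) *
          (ρ (r i • v) : ℂ) := by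
  -- The rescaled region where the cutoff can be nonzero and where the bounds on the phase are
  -- available.
  set S : ι → Set (E n) := fun i => {v | ‖r i • v‖ₑ ≤ 2 * η} with hS
  have hrabs : ∀ i, |r i| ≤ 1 := fun i => by rw [abs_of_pos (hr i)]; exact hr1 i
  have hnorm : ∀ i (v : E n), ‖r i • v‖ ≤ ‖v‖ := fun i v => by
    rw [norm_smul, Real.norm_eq_abs]
    exact mul_le_of_le_one_left (norm_nonneg _) (hrabs i)
  have hG : GaussGrowth 0 S fun i v => G i (x i + r i • v) := by
    refine GaussGrowth.comp_scale hGs hrabs fun k => ?_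
    obtain ⟨C, hC⟩ := hGb k
    exact ⟨C, 0, fun i v _ => by simpa using hC i _⟩
  have hm : GaussGrowth 0 S fun (_ : ι) v => (monomial α v : ℂ) :=
    GaussGrowth.of_hasTemperateGrowth (hasTemperateGrowth_monomial α)
  have hρt := hasTemperateGrowth_cutoff hρ
  have hρg : GaussGrowth 0 S fun i v => (ρ (r i • v) : ℂ) := by
    have := GaussGrowth.comp_scale (S := S) (f := fun _ y => (ρ y : ℂ)) (x := fun _ => 0)
      (fun _ => hρt.1) hrabs fun k => by
        obtain ⟨M, C, hC⟩ := hρt.2 k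
        have hC0 : 0 ≤ C := by simpa using (norm_nonneg _).trans (hC 0)
        refine ⟨C, M, fun i v _ => (hC _).trans ?_⟩
        rw [zero_add]
        gcongr
        exact hnorm i v
    simpa using this
  set L : ι → E n →L[ℝ] ℂ := fun i => Complex.ofRealCLM.comp (innerSL ℝ (p i)) with hL
  -- Removing the linear part makes the gradient vanish at `0` and leaves all derivatives of order
  -- at least two unchanged.
  set χ : ι → E n → ℂ := fun i y => φ i y - L i y with hχ
  have hχs : ∀ i, ContDiff ℝ ∞ (χ i) := fun i => (hφs i).sub (L i).contDiff
  have hχd : ∀ i y, fderiv ℝ (χ i) y = fderiv ℝ (φ i) y - L i := fun i y => by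
    rw [hχ]
    exact ((((hφs i).differentiable (by simp) y).hasFDerivAt).sub (L i).hasFDerivAt).fderiv
  have hχk : ∀ k i y, ‖iteratedFDeriv ℝ (k + 2) (χ i) y‖ = ‖iteratedFDeriv ℝ (k + 2) (φ i) y‖ := by
    intro k i y
    rw [← norm_iteratedFDeriv_fderiv, ← norm_iteratedFDeriv_fderiv, ← norm_iteratedFDeriv_fderiv,
      ← norm_iteratedFDeriv_fderiv]
    congr 2
    funext y
    rw [show fderiv ℝ (χ i) = fun y => fderiv ℝ (φ i) y - L i from funext (hχd i)]
    exact fderiv_sub_const _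
  -- The mean value inequality on the ball of radius `‖y‖` turns the vanishing gradient into a
  -- factor `‖y‖`.
  have hχ1 : ∃ (C : ℝ) (M : ℕ), 0 ≤ C ∧ ∀ i y, ‖y‖ₑ ≤ 2 * η →
      ‖iteratedFDeriv ℝ 1 (χ i) y‖ ≤ C * (1 + ‖y‖) ^ M * ‖y‖ := by
    obtain ⟨C, M, hC⟩ := hφb 2
    refine ⟨|C|, M, abs_nonneg _, fun i y hy => ?_⟩
    have h0 : fderiv ℝ (χ i) 0 = 0 := by
      rw [hχd]
      ext v
      simp [hφ0, hL]
    have hmv := (convex_closedBall (0 : E n) ‖y‖).norm_image_sub_le_of_norm_fderiv_le (𝕜 := ℝ)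
      (f := fderiv ℝ (χ i)) (C := |C| * (1 + ‖y‖) ^ M) (x := 0) (y := y)
      (fun u _ => ((hχs i).fderiv_right (m := ∞) (by simp)).differentiable (by simp) u)
      (fun u hu => by
        rw [mem_closedBall_zero_iff] at hu
        rw [← norm_iteratedFDeriv_one, norm_iteratedFDeriv_fderiv, hχk 0 i u]
        have hu' : ‖u‖ₑ ≤ 2 * η := (enorm_le_iff_norm_le.2 hu).trans hy
        refine (hC i u hu').trans ?_
        gcongr
        exact le_abs_self C) (by simp) (by simp)
    rw [h0, sub_zero, sub_zero] at hmv
    rwa [norm_iteratedFDeriv_one]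
  have he : GaussGrowth w S fun i v => Complex.exp
      (Complex.I * (φ i (r i • v) - (inner ℝ (p i) (r i • v) : ℝ)) / (r i : ℂ) ^ 2) := by
    have hform : ∀ i, (fun v : E n =>
        Complex.I * (φ i (r i • v) - (inner ℝ (p i) (r i • v) : ℝ)) / (r i : ℂ) ^ 2)
        = (Complex.I / (r i : ℂ) ^ 2) • fun v => χ i (r i • v) := by
      intro i
      funext v
      simp [hχ, hL]
      ring
    have hrc : ∀ i, ‖Complex.I / (r i : ℂ) ^ 2‖ = (r i ^ 2)⁻¹ := fun i => by simp
    have hcs : ∀ i, ContDiff ℝ ∞ fun v => χ i (r i • v) := fun i =>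
      (hχs i).comp (contDiff_id.const_smul _)
    -- Order `k` carries `r^{k-2}`, harmless for `k ≥ 2`. For `k = 1` the missing power of `r` is
    -- the factor `‖r • v‖` from `hχ1`.
    have hder : ∀ k i v, ‖iteratedFDeriv ℝ k (fun v : E n =>
        Complex.I * (φ i (r i • v) - (inner ℝ (p i) (r i • v) : ℝ)) / (r i : ℂ) ^ 2) v‖
        = (r i ^ 2)⁻¹ * (r i ^ k * ‖iteratedFDeriv ℝ k (χ i) (r i • v)‖) := by
      intro k i v
      have hk : (k : ℕ∞ω) ≤ (∞ : ℕ∞ω) := by exact_mod_cast le_top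
      rw [hform, iteratedFDeriv_const_smul_apply ((hcs i).of_le hk).contDiffAt, norm_smul, hrc,
        congrFun (iteratedFDeriv_comp_const_smul (r i) ((hχs i).of_le hk)) v, norm_smul, norm_pow,
        Real.norm_of_nonneg (hr i).le]
    refine GaussGrowth.cexp (fun i => ?_) (fun k hk => ?_) fun i v hv => ?_
    · rw [hform]
      exact contDiff_const.mul (hcs i)
    · obtain ⟨k, rfl⟩ : ∃ l, k = l + 1 := ⟨k - 1, by omega⟩
      rcases Nat.eq_zero_or_pos k with rfl | hk'
      · obtain ⟨C, M, hC0, hC⟩ := hχ1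
        refine ⟨C, M + 1, fun i v hv => ?_⟩
        rw [zero_add, hder]
        have hri := hr i
        calc _ ≤ (r i ^ 2)⁻¹ * (r i ^ 1 * (C * (1 + ‖r i • v‖) ^ M * ‖r i • v‖)) := by
              gcongr
              exact hC i _ hv
          _ = C * (1 + ‖r i • v‖) ^ M * ‖v‖ := by
              rw [norm_smul, Real.norm_of_nonneg hri.le]
              field_simp
          _ ≤ C * (1 + ‖v‖) ^ M * (1 + ‖v‖) := by
              gcongr
              · exact hnorm i v
              · linarith
          _ = _ := by ring
      · obtain ⟨l, rfl⟩ : ∃ l, k = l + 1 := ⟨k - 1, by omega⟩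
        obtain ⟨C, M, hC⟩ := hφb (l + 2)
        refine ⟨|C|, M, fun i v hv => ?_⟩
        rw [hder, show l + 1 + 1 = l + 2 from rfl, hχk l]
        have hri := hr i
        calc _ ≤ (r i ^ 2)⁻¹ * (r i ^ (l + 2) * (|C| * (1 + ‖r i • v‖) ^ M)) := by
              gcongr
              refine (hC i _ hv).trans ?_
              gcongr
              exact le_abs_self C
          _ = r i ^ l * (|C| * (1 + ‖r i • v‖) ^ M) := by
              rw [pow_add]
              field_simp
          _ ≤ 1 * (|C| * (1 + ‖v‖) ^ M) := by
              gcongr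
              · exact pow_le_one₀ hri.le (hr1 i)
              · exact hnorm i v
          _ = _ := one_mul _
    · have hri := hr i
      have h1 : Complex.I * (φ i (r i • v) - (inner ℝ (p i) (r i • v) : ℝ)) / (r i : ℂ) ^ 2
          = ((r i ^ 2)⁻¹ : ℝ) *
            (Complex.I * (φ i (r i • v) - (inner ℝ (p i) (r i • v) : ℝ))) := by
        push_cast
        ring
      have h2 := hφw i _ hv
      rw [h1, Complex.re_ofReal_mul]
      -- The subtracted linear phase is real, so the real part of the exponent is `-Im φ(rv)/r²`, at
      -- most `-w|v|²`.
      simp only [Complex.mul_re, Complex.I_re, Complex.I_im, Complex.sub_im, Complex.ofReal_im]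
      rw [norm_smul, Real.norm_of_nonneg hri.le, mul_pow] at h2
      have h3 : (r i ^ 2)⁻¹ * (w * (r i ^ 2 * ‖v‖ ^ 2)) = w * ‖v‖ ^ 2 := by field_simp
      have h4 := mul_le_mul_of_nonneg_left h2 (inv_nonneg.2 (sq_nonneg (r i)))
      rw [h3] at h4
      linarith
  have hall := ((hG.mul hm).mul he).mul hρg
  simp only [zero_add, add_zero] at hall
  refine hall.of_eq_zero (fun i => ?_) fun i v hv => ?_
  · exact isClosed_le (by fun_prop) continuous_const
  · rw [hρ.eq_zero _ (le_of_lt (not_le.1 hv))]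
    simp

end

/-! ### Reduction of the oscillatory integral to packets -/

section


variable {n : ℕ}

theorem P2.smoothSlices {T : ℝ} {Φ : ℝ → E n → E n → ℂ} (h : P2 T Φ) (K : Set (E n)) :
    SmoothSlices (Icc 0 T ×ˢ K) fun q : ℝ × E n => fun y => Φ q.1 y q.2 :=
  ContDiffOn.comp (t := Icc 0 T ×ˢ univ ×ˢ univ) h
    (f := fun q : (ℝ × E n) × E n => (q.1.1, q.2, q.1.2))
    (by fun_prop) fun q hq => ⟨hq.1.1, mem_univ _, mem_univ _⟩

theorem P5.smoothSlices {T : ℝ} {K : Set (E n)} {g : ℝ → E n → E n → ℂ} (h : P5 T K g) :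
    SmoothSlices (Icc 0 T ×ˢ K) fun q : ℝ × E n => fun y => g q.1 y q.2 :=
  ContDiffOn.comp (t := Icc 0 T ×ˢ univ ×ˢ K) h.1
    (f := fun q : (ℝ × E n) × E n => (q.1.1, q.2, q.1.2))
    (by fun_prop) fun q hq => ⟨hq.1.1, mem_univ _, hq.1.2⟩

/-- The derivatives of the phase grow at most polynomially where the cutoff is active. -/
theorem exists_phase_bound {T : ℝ} {K : Set (E n)} (hK : IsCompact K) {η : ℝ≥0∞}
    {Φ : ℝ → E n → E n → ℂ} (h : P2 T Φ) (hpoly : η = ⊤ → IsPolynomialPhase T Φ) (k : ℕ) :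
    ∃ (C : ℝ) (M : ℕ), ∀ t ∈ Icc 0 T, ∀ z ∈ K, ∀ y, ‖y‖ₑ ≤ 2 * η →
      ‖iteratedFDeriv ℝ k (fun y => Φ t y z) y‖ ≤ C * (1 + ‖y‖) ^ M := by
  by_cases hη : η = ⊤
  · obtain ⟨d, c, hc, hΦ⟩ := hpoly hη
    have hcb : ∀ β, ∃ B : ℝ, ∀ t ∈ Icc 0 T, ∀ z ∈ K, ‖c β t z‖ ≤ B := by
      intro β
      obtain ⟨B, hB⟩ := (isCompact_Icc.prod hK).exists_bound_of_continuousOn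
        ((hc β).continuousOn.mono (prod_mono_right (subset_univ K)))
      exact ⟨B, fun t ht z hz => hB (t, z) ⟨ht, hz⟩⟩
    choose B hB using hcb
    have hg : GaussGrowth 0 (fun _ => univ)
        fun (i : {q : ℝ × E n // q.1 ∈ Icc 0 T ∧ q.2 ∈ K}) (y : E n) =>
          ∑ β ∈ multiIndicesLE n d, c β i.1.1 i.1.2 * (monomial β y : ℂ) := by
      refine GaussGrowth.sum _ fun β _ => ?_
      have := (GaussGrowth.const (n := n) (S := fun _ => univ)
        (c := fun i : {q : ℝ × E n // q.1 ∈ Icc 0 T ∧ q.2 ∈ K} => c β i.1.1 i.1.2)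
        fun i => hB β _ i.2.1 _ i.2.2).mul
        (GaussGrowth.of_hasTemperateGrowth (hasTemperateGrowth_monomial β))
      rwa [zero_add] at this
    obtain ⟨C, M, hC⟩ := hg.bound k
    refine ⟨C, M, fun t ht z hz y _ => ?_⟩
    have := hC ⟨(t, z), ht, hz⟩ y (mem_univ _)
    rw [show (fun y => Φ t y z) = fun y => ∑ β ∈ multiIndicesLE n d, c β t z * (monomial β y : ℂ)
      from funext fun y => hΦ t ht y z]
    simpa using this
  · have h2η : 2 * η ≠ ⊤ := ENNReal.mul_ne_top (by simp) hη
    obtain ⟨C, hC⟩ := (h.smoothSlices K).exists_bound_iteratedFDeriv (isCompact_Icc.prod hK)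
      (isCompact_closedBall (0 : E n) (2 * η).toReal) k
    refine ⟨C, 0, fun t ht z hz y hy => ?_⟩
    have hy' : y ∈ Metric.closedBall (0 : E n) (2 * η).toReal := by
      rw [mem_closedBall_zero_iff, ← toReal_enorm]
      exact ENNReal.toReal_mono h2η hy
    simpa using hC (t, z) ⟨ht, hz⟩ y hy'

/-- The real part of the gradient of the phase at the centre of the beam. -/
def momentum (Φ : ℝ → E n → E n → ℂ) (t : ℝ) (z : E n) : E n :=
  WithLp.toLp 2 fun i => (gradY Φ t 0 z i).re

theorem ofReal_momentum {T : ℝ} {K : Set (E n)} {Φ : ℝ → E n → E n → ℂ} {x : ℝ → E n → E n}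
    (h : P3 T K Φ x) {t : ℝ} (ht : t ∈ Icc 0 T) {z : E n} (hz : z ∈ K) (i : Fin n) :
    ((momentum Φ t z i : ℝ) : ℂ) = gradY Φ t 0 z i := by
  apply Complex.ext
  · simp [momentum]
  · simp [h.1 t ht z hz i]

theorem fderiv_phase {T : ℝ} {K : Set (E n)} {Φ : ℝ → E n → E n → ℂ} {x : ℝ → E n → E n}
    (h : P3 T K Φ x) {t : ℝ} (ht : t ∈ Icc 0 T) {z : E n} (hz : z ∈ K) (v : E n) :
    fderiv ℝ (fun y => Φ t y z) 0 v = (inner ℝ (momentum Φ t z) v : ℝ) := by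
  rw [fderiv_eq_sum_pderiv]
  have := fun i => ofReal_momentum h ht hz i
  simp only [gradY] at this
  simp [PiLp.inner_apply, this]

theorem norm_momentum_sub {T : ℝ} {K : Set (E n)} {Φ : ℝ → E n → E n → ℂ} {x : ℝ → E n → E n}
    (h : P3 T K Φ x) {t : ℝ} (ht : t ∈ Icc 0 T) {z z' : E n} (hz : z ∈ K) (hz' : z' ∈ K) :
    ‖momentum Φ t z - momentum Φ t z'‖ = ‖gradY Φ t 0 z - gradY Φ t 0 z'‖ := by
  rw [EuclideanSpace.norm_eq, EuclideanSpace.norm_eq]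
  congr 2
  funext i
  rw [PiLp.sub_apply, PiLp.sub_apply, ← ofReal_momentum h ht hz, ← ofReal_momentum h ht hz',
    ← Complex.ofReal_sub, Complex.norm_real]

/-- Testing the derivative on the momentum itself gives `|p|² ≤ ‖DΦ‖ |p|`. -/
theorem norm_momentum_le {T : ℝ} {K : Set (E n)} {Φ : ℝ → E n → E n → ℂ} {x : ℝ → E n → E n}
    (h : P3 T K Φ x) {t : ℝ} (ht : t ∈ Icc 0 T) {z : E n} (hz : z ∈ K) :
    ‖momentum Φ t z‖ ≤ ‖fderiv ℝ (fun y => Φ t y z) 0‖ := by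
  have h1 := (fderiv ℝ (fun y => Φ t y z) 0).le_opNorm (momentum Φ t z)
  rw [fderiv_phase h ht hz, Complex.norm_real, real_inner_self_eq_norm_sq,
    Real.norm_of_nonneg (sq_nonneg _), sq] at h1
  rcases (norm_nonneg (momentum Φ t z)).eq_or_lt with h0 | h0
  · rw [← h0]; exact norm_nonneg _
  · exact le_of_mul_le_mul_right h1 h0

theorem monomial_smul (α : MultiIndex n) (r : ℝ) (v : E n) :
    monomial α (r • v) = r ^ order α * monomial α v := by
  simp [monomial, order, mul_pow, Finset.prod_mul_distrib, Finset.prod_pow_eq_pow_sum]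

/-- The integrand of the oscillatory integral, with its normalization. -/
def beam (ρ : E n → ℝ) (α : MultiIndex n) (Φ : ℝ → E n → E n → ℂ) (x : ℝ → E n → E n)
    (g : ℝ → E n → E n → ℂ) (ε t : ℝ) (z y : E n) : ℂ :=
  ((ε ^ (-(((n : ℝ) + (order α : ℝ)) / 2)) : ℝ) : ℂ) *
    (g t y z * (monomial α (y - x t z) : ℂ) *
      Complex.exp (Complex.I * Φ t (y - x t z) z / (ε : ℂ)) * (ρ (y - x t z) : ℂ))

theorem oscIntegral_eq_integral_beam (K : Set (E n)) (ρ : E n → ℝ) (α : MultiIndex n)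
    (Φ : ℝ → E n → E n → ℂ) (x : ℝ → E n → E n) (g : ℝ → E n → E n → ℂ) (ε t : ℝ) :
    oscIntegral K ρ α Φ x g ε t = fun y => ∫ z in K, beam ρ α Φ x g ε t z y := by
  funext y
  simp only [oscIntegral, beam]
  rw [integral_const_mul]

theorem smoothSlices_beam {T : ℝ} {K : Set (E n)} {η : ℝ≥0∞} {ρ : E n → ℝ} (hρ : IsCutoff η ρ)
    {Φ : ℝ → E n → E n → ℂ} {x : ℝ → E n → E n} {g : ℝ → E n → E n → ℂ} (α : MultiIndex n)
    (h1 : P1 T x) (h2 : P2 T Φ) (h5 : P5 T K g) (ε : ℝ) {t : ℝ} (ht : t ∈ Icc 0 T) :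
    SmoothSlices K (beam ρ α Φ x g ε t) := by
  have hx : ContDiffOn ℝ ∞ (fun q : E n × E n => q.2 - x t q.1) (K ×ˢ univ) :=
    contDiffOn_snd.sub (ContDiffOn.comp (t := Icc 0 T ×ˢ univ) h1
      (f := fun q : E n × E n => (t, q.1)) (by fun_prop) fun q _ => ⟨ht, mem_univ _⟩)
  have hg : ContDiffOn ℝ ∞ (fun q : E n × E n => g t q.2 q.1) (K ×ˢ univ) :=
    ContDiffOn.comp (t := Icc 0 T ×ˢ univ ×ˢ K) h5.1 (f := fun q : E n × E n => (t, q.2, q.1))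
      (by fun_prop) fun q hq => ⟨ht, mem_univ _, hq.1⟩
  have hΦ : ContDiffOn ℝ ∞ (fun q : E n × E n => Φ t (q.2 - x t q.1) q.1) (K ×ˢ univ) :=
    ContDiffOn.comp (t := Icc 0 T ×ˢ univ ×ˢ univ) h2
      (f := fun q : E n × E n => (t, q.2 - x t q.1, q.1))
      (contDiffOn_const.prodMk (hx.prodMk contDiffOn_fst)) fun q _ => ⟨ht, mem_univ _, mem_univ _⟩
  have hm : ContDiffOn ℝ ∞ (fun q : E n × E n => (monomial α (q.2 - x t q.1) : ℂ)) (K ×ˢ univ) :=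
    (hasTemperateGrowth_monomial α).1.comp_contDiffOn hx
  have hr : ContDiffOn ℝ ∞ (fun q : E n × E n => (ρ (q.2 - x t q.1) : ℂ)) (K ×ˢ univ) :=
    (hasTemperateGrowth_cutoff hρ).1.comp_contDiffOn hx
  exact contDiffOn_const.mul
    (((hg.mul hm).mul ((contDiffOn_const.mul hΦ).div_const _).cexp).mul hr)

theorem beam_eq_packet (ρ : E n → ℝ) (α : MultiIndex n) (Φ : ℝ → E n → E n → ℂ)
    (x : ℝ → E n → E n) (g : ℝ → E n → E n → ℂ) {ε : ℝ} (hε : 0 < ε) (t : ℝ) (z p y : E n) :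
    beam ρ α Φ x g ε t z y = (((√ε ^ n)⁻¹ : ℝ) : ℂ) * packet √ε (x t z) p (fun v =>
      g t (x t z + √ε • v) z * (monomial α v : ℂ) *
        Complex.exp (Complex.I * (Φ t (√ε • v) z - (inner ℝ p (√ε • v) : ℝ)) / (√ε : ℂ) ^ 2) *
          (ρ (√ε • v) : ℂ)) y := by
  have hr : 0 < √ε := Real.sqrt_pos.2 hε
  have hrc : (√ε : ℂ) ≠ 0 := by exact_mod_cast hr.ne'
  have hsq : (ε : ℂ) = (√ε : ℂ) ^ 2 := by
    rw [← Complex.ofReal_pow, Real.sq_sqrt hε.le]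
  have hpow : ε ^ (-(((n : ℝ) + (order α : ℝ)) / 2)) = (√ε ^ n)⁻¹ * (√ε ^ order α)⁻¹ := by
    rw [← mul_inv, ← pow_add, Real.sqrt_eq_rpow, ← Real.rpow_natCast, ← Real.rpow_mul hε.le,
      ← Real.rpow_neg hε.le]
    congr 1
    push_cast
    ring
  have hv : √ε • ((√ε)⁻¹ • (y - x t z)) = y - x t z := by
    rw [smul_smul, mul_inv_cancel₀ hr.ne', one_smul]
  have hm : monomial α (y - x t z) = √ε ^ order α * monomial α ((√ε)⁻¹ • (y - x t z)) := by
    rw [← monomial_smul, hv]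
  have hexp : Complex.exp (Complex.I * Φ t (y - x t z) z / (√ε : ℂ) ^ 2)
      = Complex.exp (Complex.I * (inner ℝ p (y - x t z) : ℝ) / (√ε : ℂ) ^ 2) *
        Complex.exp (Complex.I * (Φ t (y - x t z) z - (inner ℝ p (y - x t z) : ℝ)) /
          (√ε : ℂ) ^ 2) := by
    rw [← Complex.exp_add]
    congr 1
    ring
  simp only [beam, packet, hv]
  rw [hpow, hm, hsq, hexp, add_sub_cancel]
  push_cast
  field_simp

/-- Each derivative of the oscillatory integral costs at most a factor `ε⁻¹` in `L²`. -/
theorem exists_bound_partialD_oscIntegral {T : ℝ} {K : Set (E n)} (hK : IsCompact K) {η : ℝ≥0∞}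
    {ρ : E n → ℝ} (hρ : IsCutoff η ρ) {Φ : ℝ → E n → E n → ℂ} {x : ℝ → E n → E n}
    {g : ℝ → E n → E n → ℂ} (α : MultiIndex n) (h1 : P1 T x) (h2 : P2 T Φ) (h3 : P3 T K Φ x)
    (h4 : P4 T K η Φ) (hpoly : η = ⊤ → IsPolynomialPhase T Φ) (h5 : P5 T K g)
    (β : MultiIndex n) :
    ∃ B : ℝ, 0 ≤ B ∧ ∀ ε : ℝ, 0 < ε → ε ≤ 1 → ∀ t ∈ Icc 0 T,
      eLpNorm (partialD β (oscIntegral K ρ α Φ x g ε t)) 2 volume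
        ≤ ENNReal.ofReal (B * ε ^ (-(order β : ℝ))) := by
  obtain ⟨w, hw, h4⟩ := h4
  obtain ⟨c, hc, hsep⟩ := h3.2
  -- Indexing by all admissible `(ε, t, z)` makes every constant below uniform in these three.
  let ι : Type := {q : ℝ × ℝ × E n // 0 < q.1 ∧ q.1 ≤ 1 ∧ q.2.1 ∈ Icc 0 T ∧ q.2.2 ∈ K}
  let r : ι → ℝ := fun i => √i.1.1
  let p : ι → E n := fun i => momentum Φ i.1.2.1 i.1.2.2
  let X : ι → E n := fun i => x i.1.2.1 i.1.2.2
  let G : ι → E n → ℂ := fun i y => g i.1.2.1 y i.1.2.2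
  let φ : ι → E n → ℂ := fun i y => Φ i.1.2.1 y i.1.2.2
  have hr : ∀ i, 0 < r i := fun i => Real.sqrt_pos.2 i.2.1
  have hr1 : ∀ i, r i ≤ 1 := fun i => Real.sqrt_le_one.2 i.2.2.1
  have hGs : ∀ i, ContDiff ℝ ∞ (G i) := fun i =>
    h5.smoothSlices.contDiff (a := i.1.2) ⟨i.2.2.2.1, i.2.2.2.2⟩
  have hφs : ∀ i, ContDiff ℝ ∞ (φ i) := fun i =>
    (h2.smoothSlices K).contDiff (a := i.1.2) ⟨i.2.2.2.1, i.2.2.2.2⟩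
  have hφb : ∀ k, ∃ (C : ℝ) (M : ℕ), ∀ i y, ‖y‖ₑ ≤ 2 * η →
      ‖iteratedFDeriv ℝ k (φ i) y‖ ≤ C * (1 + ‖y‖) ^ M := fun k => by
    obtain ⟨C, M, hC⟩ := exists_phase_bound hK h2 hpoly k
    exact ⟨C, M, fun i => hC _ i.2.2.2.1 _ i.2.2.2.2⟩
  obtain ⟨P, hP⟩ : ∃ P : ℝ, ∀ i, ‖p i‖ ≤ P := by
    obtain ⟨C, M, hC⟩ := hφb 1
    refine ⟨C, fun i => (norm_momentum_le h3 i.2.2.2.1 i.2.2.2.2).trans ?_⟩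
    simpa [norm_iteratedFDeriv_one] using hC i 0 (by simp)
  have hprof := gaussGrowth_profile (x := X) (p := p) (G := G) (φ := φ) (w := w) hρ α hr hr1 hGs
    (fun k => exists_bound_iteratedFDeriv_of_partialD k hGs fun β => by
      obtain ⟨C, hC⟩ := h5.2 β
      exact ⟨C, fun i => hC _ i.2.2.2.1 _ i.2.2.2.2⟩)
    hφs hφb (fun i v => fderiv_phase h3 i.2.2.2.1 i.2.2.2.2 v)
    (fun i => h4 _ i.2.2.2.1 _ i.2.2.2.2)
  obtain ⟨a, ha, hpa⟩ := exists_partialD_packet (x := X) hr hr1 hP hprof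
    (fun i => (((r i ^ n)⁻¹ : ℝ) : ℂ)) β
  -- Half of the rate `w` is given up to absorb the polynomial factors.
  obtain ⟨C, hC0, hC⟩ := ha.absorb (half_lt_self hw) (n + 1)
  obtain ⟨B, hB0, hB⟩ := exists_superposition_bound hK (half_pos hw) hC0 hc
  refine ⟨B, hB0, fun ε hε hε1 t ht => ?_⟩
  classical
  -- The profile exists only for `z ∈ K`; the value `0` elsewhere is immaterial, as all integrals
  -- run over `K`.
  let a' : E n → E n → ℂ := fun z =>
    if hz : z ∈ K then a ⟨(ε, t, z), hε, hε1, ht, hz⟩ else 0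
  have ha' : ∀ z (hz : z ∈ K), a' z = a ⟨(ε, t, z), hε, hε1, ht, hz⟩ := fun z hz => dif_pos hz
  have hsm := smoothSlices_beam hρ α h1 h2 h5 ε ht
  have hr0 : 0 < √ε := Real.sqrt_pos.2 hε
  set s : ℝ := (√ε ^ n)⁻¹ * ((√ε ^ 2)⁻¹) ^ order β with hs
  have hspos : 0 < s := by positivity
  have hbeam : ∀ z ∈ K, ∀ y, partialD β (beam ρ α Φ x g ε t z) y
      = (s : ℂ) * packet √ε (x t z) (momentum Φ t z) (a' z) y := by
    intro z hz y
    rw [show beam ρ α Φ x g ε t z = _ from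
      funext (beam_eq_packet ρ α Φ x g hε t z (momentum Φ t z)), ha' z hz]
    refine (congrFun (hpa ⟨(ε, t, z), hε, hε1, ht, hz⟩) y).trans ?_
    simp only [hs, r, X, p]
    push_cast
    ring
  have hosc : partialD β (oscIntegral K ρ α Φ x g ε t)
      = (s : ℂ) • fun y => ∫ z in K, packet √ε (x t z) (momentum Φ t z) (a' z) y := by
    rw [oscIntegral_eq_integral_beam, hsm.partialD_integral hK β]
    funext y
    rw [Pi.smul_apply, smul_eq_mul, ← integral_const_mul]
    exact setIntegral_congr_fun hK.measurableSet fun z hz => hbeam z hz y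
  -- The profiles `a` come with no information on their dependence on `z`; joint continuity is read
  -- off from the derivative of the beam, a nonzero multiple of the packet.
  have hcont : ContinuousOn (fun q : E n × E n =>
      packet √ε (x t q.1) (momentum Φ t q.1) (a' q.1) q.2) (K ×ˢ univ) := by
    refine ((continuousOn_const (c := (s : ℂ)⁻¹)).mul
      (hsm.partialD β).continuousOn).congr fun q hq => ?_
    change _ = (s : ℂ)⁻¹ * partialD β (beam ρ α Φ x g ε t q.1) q.2
    rw [hbeam q.1 hq.1, inv_mul_cancel_left₀ (by exact_mod_cast hspos.ne')]
  have hle := hB √ε (x t) (momentum Φ t) a' hr0 hcont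
    (fun z hz => by rw [ha' z hz]; exact ha.smooth _)
    (fun z hz j hj v => by rw [ha' z hz]; exact hC j hj _ v)
    (fun z hz z' hz' => by
      rw [norm_momentum_sub h3 ht hz hz']
      exact hsep t ht z hz z' hz')
  rw [hosc, eLpNorm_const_smul]
  -- The factor `rⁿ` of the superposition cancels `r⁻ⁿ` in `s`, leaving `r^{-2|β|} = ε^{-|β|}`.
  calc _ ≤ ENNReal.ofReal s * ENNReal.ofReal (B * √ε ^ n) := by
        gcongr
        rw [← ofReal_norm, Complex.norm_real, Real.norm_of_nonneg hspos.le]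
    _ = _ := by
        rw [← ENNReal.ofReal_mul hspos.le, Real.rpow_neg hε.le, Real.rpow_natCast, hs,
          Real.sq_sqrt hε.le, inv_pow]
        congr 1
        field_simp

end

end GaussianBeam

end

theorem mainTheorem5 (n s : ℕ) (T : ℝ) (hT : 0 < T)
    (K₀ : Set (GaussianBeam.E n)) (hK₀ : IsCompact K₀)
    (η : ℝ≥0∞) (hη : 0 < η) (ρ : GaussianBeam.E n → ℝ) (hρ : GaussianBeam.IsCutoff η ρ)
    (Φ : ℝ → GaussianBeam.E n → GaussianBeam.E n → ℂ)
    (x : ℝ → GaussianBeam.E n → GaussianBeam.E n)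
    (g : ℝ → GaussianBeam.E n → GaussianBeam.E n → ℂ)
    (α : GaussianBeam.MultiIndex n)
    (hP1 : GaussianBeam.P1 T x) (hP2 : GaussianBeam.P2 T Φ)
    (hP3 : GaussianBeam.P3 T K₀ Φ x) (hP4 : GaussianBeam.P4 T K₀ η Φ)
    (hpoly : η = ⊤ → GaussianBeam.IsPolynomialPhase T Φ)
    (hP5 : GaussianBeam.P5 T K₀ g) :
    ∃ C : ℝ, ∀ ε : ℝ, 0 < ε → ε ≤ 1 →
      (∀ t ∈ Set.Icc 0 T,
        ContDiff ℝ (↑(⊤ : ℕ∞)) (GaussianBeam.oscIntegral K₀ ρ α Φ x g ε t)) ∧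
      (⨆ t ∈ Set.Icc 0 T,
          GaussianBeam.sobolevNorm s (GaussianBeam.oscIntegral K₀ ρ α Φ x g ε t)) ≤
        (⨆ t ∈ Set.Icc 0 T,
          GaussianBeam.scaledSobolevNorm ε s (GaussianBeam.oscIntegral K₀ ρ α Φ x g ε t)) ∧
      (⨆ t ∈ Set.Icc 0 T,
          GaussianBeam.scaledSobolevNorm ε s (GaussianBeam.oscIntegral K₀ ρ α Φ x g ε t)) ≤
        ENNReal.ofReal (C * ε ^ (-(s : ℝ))) := by
  choose B hB0 hB using
    GaussianBeam.exists_bound_partialD_oscIntegral hK₀ hρ α hP1 hP2 hP3 hP4 hpoly hP5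
  refine ⟨∑ β ∈ GaussianBeam.multiIndicesLE n s, B β, fun ε hε hε1 => ⟨fun t ht => ?_, ?_, ?_⟩⟩
  · rw [GaussianBeam.oscIntegral_eq_integral_beam]
    exact (GaussianBeam.smoothSlices_beam hρ α hP1 hP2 hP5 ε ht).contDiff_integral hK₀
  · refine iSup₂_mono fun t _ => Finset.sum_le_sum fun β hβ => ?_
    have hβ' : (GaussianBeam.order β : ℝ) ≤ s := by
      exact_mod_cast (GaussianBeam.mem_multiIndicesLE β).1 hβ
    -- As `ε ≤ 1` and `|β| ≤ s`, each weight `ε^{|β|-s}` is at least `1`.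
    refine le_mul_of_one_le_left zero_le ?_
    rw [← ENNReal.ofReal_one]
    exact ENNReal.ofReal_le_ofReal
      (Real.one_le_rpow_of_pos_of_le_one_of_nonpos hε hε1 (by linarith))
  · refine iSup₂_le fun t ht => ?_
    rw [Finset.sum_mul, ENNReal.ofReal_sum_of_nonneg fun β _ =>
      mul_nonneg (hB0 β) (Real.rpow_nonneg hε.le _)]
    refine Finset.sum_le_sum fun β _ => ?_
    -- The powers combine to `ε^{|β|-s} ε^{-|β|} = ε^{-s}` for every `β`.
    calc _ ≤ ENNReal.ofReal (ε ^ ((GaussianBeam.order β : ℝ) - (s : ℝ))) *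
          ENNReal.ofReal (B β * ε ^ (-(GaussianBeam.order β : ℝ))) := by
          gcongr
          exact hB β ε hε hε1 t ht
      _ = _ := by
          rw [← ENNReal.ofReal_mul (Real.rpow_nonneg hε.le _), mul_left_comm,
            ← Real.rpow_add hε]
          congr 3
          ring
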